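/- **Setting (one observation).** Let $\Theta$ be a set. For each $\theta\in\Theta$ let a probability space $(S^\theta,P^\theta)$ carry: a right-continuous and complete filtration $\mathcal F=(\mathcal F_t)_{t\in[0,1]}$; an $\mathcal F$-adapted counting process $N$ (with $N_0=0$, values in $\mathbb N_0$, càdlàg nondecreasing paths and jumps of size $1$); a real càglàd process $X$; and let $\mathcal G=(\mathcal G_t)$ be the right-continuous and complete filtration generated by $\mathcal F$ and $X$. Assume that $N$ has an $\mathcal F$-intensity $\lambda$ and a $\mathcal G$-intensity $\boldsymbol\lambda$ (nonnegative predictable processes such that $N_t-\int_0^t\lambda_s\,ds$ is a local $\mathcal F$-martingale and $N_t-\int_0^t\boldsymbol\lambda_s\,ds$ is a local $\mathcal G$-martingale). Let $G$ be a residual process: càglàd, $\mathcal G$-adapted, with $E(G_t\mid\mathcal F_{t-})=0$ for all $t\in[0,1]$ (where $\mathcal F_{0-}=\mathcal F_0$). All these objects may depend on $\theta$. The variance function is $$\mathcal V^\theta(t)=E\Big(\int_0^t G_s^2\,dN_s\Big)\in[0,\infty],\qquad t\in[0,1].$$ **Sample and estimators.** For each $\theta$ let $\xi_1,\xi_2,\dots$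 be i.i.d. observations with law $P^\theta$, and write $N_j$, $G_j$, etc. for the processes evaluated at $\xi_j$. For each $n$ let $J_n\subseteq\{1,\dots,n\}$ and $J_n^c=\{1,\dots,n\}\setminus J_n$. The estimates $\hat\lambda^{(n)}$ and $\hat G^{(n)}$ are functions of the training data $(\xi_i)_{i\in J_n^c}$, of time and of one further observation, jointly measurable with respect to the product of the $\sigma$-algebra of the training data and the $\mathcal F$-predictable, respectively $\mathcal G$-predictable, $\sigma$-algebra. In particular, for fixed training data they are $\mathcal F$-predictable, respectively $\mathcal G$-predictable, processes of the further observation. Write $\hat G^{(n)}_{j}$ for the value at the observation $\xi_j$, $j\in J_n$, and $\hat\lambda^{(n)}$, $\hat G^{(n)}$ without index $j$ for the value at an additional observation with law $P^\theta$ that is independent of the training data. Let $$\hat{\mathcal V}^\theta_n(t)=\frac1{|J_n|}\sum_{j\in J_n}\int_0^t\big(\hat G^{(n)}_{j,s}\big)^2\,dN_{j,s}.$$ **Assumption 1 (uniform bounds).** There are constants $C,C'>0$ such that for every $\theta\in\Theta$, almost surely: $\boldsymbol\lambda^\theta$ is càglàd with $\sup_t\boldsymbol\lambda^\theta_t\le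 C$; $G^\theta$ is càglàd with $\sup_t|G^\theta_t|\le C'$; and the estimates satisfy the same bounds, $\sup_t|\hat\lambda^{(n),\theta}_t|\le C$ and $\sup_t|\hat G^{(n),\theta}_t|\le C'$ for all $n$. **Assumption 2 (uniform rates).** $|J_n|\to\infty$ as $n\to\infty$, and with $$g^\theta(n)^2=E\int_0^1\big(G^\theta_s-\hat G^{(n),\theta}_s\big)^2ds,\qquad h^\theta(n)^2=E\int_0^1\big(\lambda^\theta_s-\hat\lambda^{(n),\theta}_s\big)^2ds$$ it holds that $$\lim_{n\to\infty}\ \sup_{\theta\in\Theta}\ \max\big\{g^\theta(n),\,h^\theta(n),\,\sqrt{|J_n|}\,g^\theta(n)\,h^\theta(n)\big\}=0 .$$ **Proposition.** Under Assumptions 1 and 2, $\mathcal V^\theta(t)<\infty$ for all $\theta\in\Theta$ and $t\in[0,1]$, and for every $\varepsilon>0$ $$\lim_{n\to\infty}\ \sup_{\theta\in\Theta}\ \mathbb P\Big(\sup_{t\in[0,1]}\big|\hat{\mathcal V}^\theta_n(t)-\mathcal V^\theta(t)\big|>\varepsilon\Big)=0 .$$ -/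

import Mathlib

open MeasureTheory ProbabilityTheory Filter Topology unitInterval
open scoped ENNReal

namespace LCM

/-- The path `x` on `[0,1]` is left continuous with right limits. -/
def IsCaglad (x : I → ℝ) : Prop :=
  (∀ t, ContinuousWithinAt x (Set.Iic t) t) ∧ ∀ t, ∃ l, Tendsto x (𝓝[>] t) (𝓝 l)

/-- The path `f` (nondecreasing and right continuous, as every `StieltjesFunction`) is the path of
a counting process on `[0,1]`: it starts at `0`, takes values in `ℕ`, and has jumps of size one. -/
structure IsCountingPath (f : StieltjesFunction I) : Prop where
  zero : f 0 = 0
  nat : ∀ t, ∃ k : ℕ, f t = k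
  jump : ∀ t, f t - Function.leftLim f t ≤ 1

section OneObservation

variable {S : Type*} [mS : MeasurableSpace S]

/-- The σ-algebra `𝓕_{t-}`, generated by the `𝓕_s` with `s < t`; by convention `𝓕_{0-} = 𝓕_0`. -/
@[reducible] def leftSigma (𝓕 : Filtration I mS) (t : I) : MeasurableSpace S :=
  𝓕 0 ⊔ ⨆ s, ⨆ (_ : s < t), 𝓕 s

/-- The right continuous and complete filtration generated by `𝓕` and the process `X`. -/
noncomputable def augment (P : Measure S) (𝓕 : Filtration I mS) (X : I → S → ℝ)
    (hX : ∀ t, Measurable (X t)) : Filtration I mS :=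
  (𝓕 ⊔ Filtration.natural X (fun t => (hX t).stronglyMeasurable) ⊔
    Filtration.const I (MeasurableSpace.generateFrom {A | MeasurableSet A ∧ P A = 0})
      (MeasurableSpace.generateFrom_le fun _ hA => hA.1)).rightCont

/-- `ell` is an `𝓗`-intensity of the counting process `N`: it is nonnegative and `𝓗`-predictable,
and `N - ∫ ell` is a local `𝓗`-martingale. -/
structure IsIntensity (P : Measure S) (𝓗 : Filtration I mS) (N : S → StieltjesFunction I)
    (ell : I → S → ℝ) : Prop where
  nonneg : ∀ t x, 0 ≤ ell t x
  predictable : IsStronglyPredictable 𝓗 ell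
  integrable : ∀ᵐ x ∂P, Integrable (fun s => ell s x) volume
  localMartingale : Locally (fun Y : I → S → ℝ => Martingale Y 𝓗 P) 𝓗
    (fun t x => N x t - ∫ s in Set.Ioc 0 t, ell s x) P

/-- `G` is a residual process: càglàd, adapted to the large filtration `𝓖`, and conditionally
centered, `E (G_t | 𝓕_{t-}) = 0`. -/
structure IsResidual (P : Measure S) (𝓕 𝓖 : Filtration I mS) (G : I → S → ℝ) : Prop where
  caglad : ∀ x, IsCaglad fun t => G t x
  adapted : Adapted 𝓖 G
  integrable : ∀ t, Integrable (G t) P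
  centered : ∀ t, P[G t | leftSigma 𝓕 t] =ᵐ[P] 0

/-- The processes attached to one observation, for one sampling distribution. An observation is a
point of the sample space `S` with law `P`. -/
structure Setup (P : Measure S) where
  /-- the observed filtration -/
  𝓕 : Filtration I mS
  rightContinuous : 𝓕.IsRightContinuous
  complete : ∀ A, MeasurableSet A → P A = 0 → MeasurableSet[𝓕 0] A
  /-- the counting process -/
  N : S → StieltjesFunction I
  counting : ∀ x, IsCountingPath (N x)
  adapted_N : Adapted 𝓕 fun t x => N x t
  /-- the auxiliary process -/
  X : I → S → ℝ
  measurable_X : ∀ t, Measurable (X t)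
  caglad_X : ∀ x, IsCaglad fun t => X t x
  /-- the `𝓕`-intensity of `N` -/
  lam : I → S → ℝ
  intensity_lam : IsIntensity P 𝓕 N lam
  /-- the intensity of `N` with respect to the filtration generated by `𝓕` and `X` -/
  blam : I → S → ℝ
  intensity_blam : IsIntensity P (augment P 𝓕 X measurable_X) N blam
  /-- the residual process -/
  G : I → S → ℝ
  residual : IsResidual P 𝓕 (augment P 𝓕 X measurable_X) G

/-- The right continuous and complete filtration generated by `𝓕` and `X`. -/
noncomputable def Setup.𝓖 {P : Measure S} (M : Setup P) : Filtration I mS :=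
  augment P M.𝓕 M.X M.measurable_X

/-- The variance function `t ↦ E (∫_0^t G_s^2 dN_s)`, with values in `[0,∞]`. -/
noncomputable def Setup.variance {P : Measure S} (M : Setup P) (t : I) : ℝ≥0∞ :=
  ∫⁻ x, ∫⁻ s in Set.Ioc 0 t, ENNReal.ofReal (M.G s x ^ 2) ∂(M.N x).measure ∂P

/-- `e` is an estimate of a process that can be evaluated on the basis of `𝓗`. Its functional form
is determined by the training data `d : D`, and for given `d` it is an `𝓗`-predictable process;
joint measurability in `d`, time and the new observation is required. -/
def IsEstimate {D : Type*} [mD : MeasurableSpace D] (𝓗 : Filtration I mS)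
    (e : D → I → S → ℝ) : Prop :=
  Measurable[mD.prod 𝓗.predictable] fun z : D × (I × S) => e z.1 z.2.1 z.2.2

/-- The norm in `L_2([0,1] × Ω)` of `u - e`, where `e` is fitted on training data with law `ν` and
evaluated on an independent observation with law `P`. -/
noncomputable def estimationError {D : Type*} [MeasurableSpace D] (ν : Measure D) (P : Measure S)
    (u : I → S → ℝ) (e : D → I → S → ℝ) : ℝ≥0∞ :=
  eLpNorm (fun z : D × (S × I) => u z.2.2 z.2.1 - e z.1 z.2.2 z.2.1) 2
    (ν.prod (P.prod volume))

end OneObservation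

/-- Data sets of observations in `S` indexed by the complement of `J n` in `{1,…,n}`. -/
abbrev Training (J : ℕ → Finset ℕ) (n : ℕ) (S : Type*) : Type _ :=
  {i // i ∈ Finset.Icc 1 n \ J n} → S

/-- The law of the training data, when the observations are i.i.d. with law `P`. -/
noncomputable def trainingLaw (J : ℕ → Finset ℕ) (n : ℕ) {S : Type*} [MeasurableSpace S]
    (P : Measure S) : Measure (Training J n S) :=
  Measure.pi fun _ => P

/-- The empirical variance function `|J_n|⁻¹ ∑_{j ∈ J_n} ∫_0^t (Ĝ_{j,s})^2 dN_{j,s}` for the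
observations `ξ 1, …, ξ n`, where `Gh` is fitted on the `ξ i` with `i ∉ J_n`. -/
noncomputable def empiricalVariance {Ω S : Type*} [MeasurableSpace S] {P : Measure S}
    (M : Setup P) (J : ℕ → Finset ℕ) (n : ℕ) (Gh : Training J n S → I → S → ℝ)
    (ξ : ℕ → Ω → S) (t : I) (ω : Ω) : ℝ :=
  ((J n).card : ℝ)⁻¹ * ∑ j ∈ J n,
    ∫ s in Set.Ioc 0 t, Gh (fun i => ξ i ω) s (ξ j ω) ^ 2 ∂(M.N (ξ j ω)).measure

section Assumptions

variable {Θ : Type*} {S : Θ → Type*} [∀ θ, MeasurableSpace (S θ)] {P : ∀ θ, Measure (S θ)}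

/-- Uniform bounds over the parameter set: the intensity and the residual process are càglàd and
bounded, and the estimates satisfy the same bounds. -/
def UniformBounds (M : ∀ θ, Setup (P θ)) (J : ℕ → Finset ℕ)
    (Lh Gh : ∀ θ n, Training J n (S θ) → I → S θ → ℝ) : Prop :=
  ∃ C > (0 : ℝ), ∃ C' > (0 : ℝ), ∀ θ,
    (∀ᵐ x ∂P θ, IsCaglad (fun t => (M θ).blam t x) ∧ ∀ t, (M θ).blam t x ≤ C) ∧
    (∀ᵐ x ∂P θ, IsCaglad (fun t => (M θ).G t x) ∧ ∀ t, |(M θ).G t x| ≤ C') ∧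
    ∀ n, ∀ᵐ z ∂(trainingLaw J n (P θ)).prod (P θ),
      ∀ t, |Lh θ n z.1 t z.2| ≤ C ∧ |Gh θ n z.1 t z.2| ≤ C'

/-- `|J_n| → ∞`, and the estimation errors `g`, `h` and `√|J_n| g h` tend to zero uniformly over
the parameter set. -/
def UniformRates (M : ∀ θ, Setup (P θ)) (J : ℕ → Finset ℕ)
    (Lh Gh : ∀ θ n, Training J n (S θ) → I → S θ → ℝ) : Prop :=
  Tendsto (fun n => (J n).card) atTop atTop ∧
  Tendsto (fun n => ⨆ θ,
    let g := estimationError (trainingLaw J n (P θ)) (P θ) (M θ).G (Gh θ n)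
    let h := estimationError (trainingLaw J n (P θ)) (P θ) (M θ).lam (Lh θ n)
    max g (max h (ENNReal.ofReal (Real.sqrt (J n).card) * g * h))) atTop (𝓝 0)

end Assumptions

end LCM

namespace LCM

/-! ### The random measure `dN` as a kernel, and predictability of left continuous processes. -/

section

/-! The deviation splits at the average over `J n` of the oracle functionals `∫_0^t G² dN`
(`Setup.quad`), which use the true residual process.

Replacing `Ĝ` by `G` costs, uniformly in `t`, at most the average of `∫_0^1 |Ĝ² - G²| dN`. Each `ξ
j` with `j ∈ J n` is independent of the training data, so with these data fixed `|Ĝ - G|` is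
`𝓖`-predictable and `dN` may be exchanged under expectation for its compensator `blam ds ≤ C ds`
(`IsIntensity.lintegral_eq`). Since `|Ĝ + G| ≤ 2C'`, the expected cost is at most `2C'C` times the
`L²` error `g(n)` (`Setup.lintegral_sqError_le`), and Markov's inequality applies.

The oracle average is a mean of i.i.d. variables dominated by `C'² N_1`. The second moment of `N_1`
is at most `2C² + C` (`IsIntensity.lintegral_sq_measure_univ_le`), so Chebyshev's inequality
controls each fixed time with constants free of `θ`. Both the average and the variance function are
monotone in `t`, and the latter is Lipschitz with constant `C'²C` (`Setup.variance_sub_le`); hence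
control on a finite grid, independent of `θ` and `n`, gives uniform control (`abs_sub_le_of_grid`).
`Setup.measure_iSup_deviation_le` combines the two bounds. -/

/-- The masses need not be bounded uniformly in `a`. Cutting the source space along the integer part
of the mass leaves countably many kernels, the `n`-th of mass at most `n + 1`. -/
theorem isSFiniteKernel_of_isFiniteMeasure {α β : Type*} [MeasurableSpace α] [MeasurableSpace β]
    (κ : Kernel α β) [∀ a, IsFiniteMeasure (κ a)] : IsSFiniteKernel κ := by
  have hmass : Measurable fun a => ⌊(κ a Set.univ).toReal⌋₊ :=
    Nat.measurable_floor.comp (κ.measurable_coe MeasurableSet.univ).ennreal_toReal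
  have hs : ∀ n : ℕ, MeasurableSet {a | ⌊(κ a Set.univ).toReal⌋₊ = n} := fun n =>
    hmass (measurableSet_singleton n)
  classical
  refine ⟨fun n => Kernel.piecewise (hs n) κ 0, fun n => ⟨(n : ℝ≥0∞) + 1, by finiteness, ?_⟩, ?_⟩
  · intro a
    rw [Kernel.piecewise_apply]
    split_ifs with h
    · have h' := (Nat.lt_floor_add_one (κ a Set.univ).toReal).le
      rw [show ⌊(κ a Set.univ).toReal⌋₊ = n from h] at h'
      rw [← ENNReal.ofReal_toReal (measure_ne_top (κ a) Set.univ)]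
      refine (ENNReal.ofReal_le_ofReal h').trans (le_of_eq ?_)
      rw [ENNReal.ofReal_add (by positivity) zero_le_one]
      simp
    · simp
  · ext a s hs'
    rw [Kernel.sum_apply' _ _ hs', tsum_eq_single ⌊(κ a Set.univ).toReal⌋₊]
    · simp [Kernel.piecewise_apply]
    · intro b hb
      rw [Kernel.piecewise_apply, if_neg]
      · simp
      · exact fun h => hb (Eq.symm h)

/-- At the least element the left limit is by convention the value itself, so a jump at time `0` is
invisible. -/
theorem stieltjes_measure_singleton_zero (f : StieltjesFunction I) : f.measure {0} = 0 := by
  rw [f.measure_singleton, leftLim_eq_of_isBot (fun x => x.2.1)]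
  simp

theorem stieltjes_measure_Iic (f : StieltjesFunction I) (t : I) :
    f.measure (Set.Iic t) = ENNReal.ofReal (f t - f 0) := by
  have h : Set.Iic t = Set.Icc 0 t := by ext s; simp
  rw [h, f.measure_Icc, leftLim_eq_of_isBot (fun x => x.2.1)]

theorem stieltjes_measure_univ (f : StieltjesFunction I) :
    f.measure Set.univ = ENNReal.ofReal (f 1 - f 0) := by
  rw [← stieltjes_measure_Iic]
  congr 1
  ext s
  exact ⟨fun _ => s.2.2, fun _ => trivial⟩

instance (f : StieltjesFunction I) : IsFiniteMeasure f.measure :=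
  ⟨by rw [stieltjes_measure_univ]; exact ENNReal.ofReal_lt_top⟩

variable {S : Type*} [mS : MeasurableSpace S]

theorem measurable_stieltjes_measure {N : S → StieltjesFunction I}
    (hN : ∀ t, Measurable fun x => N x t) : Measurable fun x => (N x).measure := by
  refine Measurable.measure_of_isPiSystem (S := Set.range Set.Iic)
    ((BorelSpace.measurable_eq (α := I)).trans (borel_eq_generateFrom_Iic I)) isPiSystem_Iic ?_ ?_
  · rintro - ⟨t, rfl⟩
    simp only [stieltjes_measure_Iic]
    exact ((hN t).sub (hN 0)).ennreal_ofReal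
  · simp only [stieltjes_measure_univ]
    exact ((hN 1).sub (hN 0)).ennreal_ofReal

/-- The random measure `dN` as a kernel. -/
noncomputable def stieltjesKernel (N : S → StieltjesFunction I)
    (hN : ∀ t, Measurable fun x => N x t) : Kernel S I :=
  ⟨fun x => (N x).measure, measurable_stieltjes_measure hN⟩

theorem stieltjesKernel_apply (N : S → StieltjesFunction I)
    (hN : ∀ t, Measurable fun x => N x t) (x : S) : stieltjesKernel N hN x = (N x).measure := rfl

instance (N : S → StieltjesFunction I) (hN : ∀ t, Measurable fun x => N x t) :
    IsSFiniteKernel (stieltjesKernel N hN) :=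
  haveI : ∀ x, IsFiniteMeasure (stieltjesKernel N hN x) := fun x => by
    rw [stieltjesKernel_apply]; infer_instance
  isSFiniteKernel_of_isFiniteMeasure _

theorem predictable_le_prod (𝓗 : Filtration I mS) :
    𝓗.predictable ≤ (inferInstance : MeasurableSpace (I × S)) :=
  measurableSpace_le_predictable_of_measurableSet
    (fun _ hA => (measurableSet_singleton _).prod (𝓗.le _ _ hA))
    (fun _ _ hA => measurableSet_Ioi.prod (𝓗.le _ _ hA))

/-- The left endpoint of the cell of the partition of `[0,1]` of mesh `1/(n+1)` containing `t`. -/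
noncomputable def cellLeft (n : ℕ) (k : ℕ) : I :=
  Set.projIcc 0 1 zero_le_one ((k : ℝ) / (n + 1))

theorem cellLeft_coe {n k : ℕ} (h : k ≤ n + 1) : (cellLeft n k : ℝ) = (k : ℝ) / (n + 1) := by
  have h1 : ((k : ℝ)) ≤ n + 1 := by exact_mod_cast h
  rw [cellLeft, Set.coe_projIcc, min_eq_right, max_eq_right]
  · positivity
  · rw [div_le_one (by positivity)]; exact h1

theorem exists_cell (n : ℕ) {t : I} (ht : 0 < t) :
    ∃ k, k ≤ n ∧ t ∈ Set.Ioc (cellLeft n k) (cellLeft n (k + 1)) := by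
  have ht0 : (0 : ℝ) < t := ht
  have hn : (0 : ℝ) < n + 1 := by positivity
  -- The cells are open on the left, so the index is the ceiling of `t (n + 1)` minus one.
  have hpos : 0 < ⌈(t : ℝ) * (n + 1)⌉₊ := Nat.ceil_pos.2 (by positivity)
  obtain ⟨k, hk⟩ := Nat.exists_eq_succ_of_ne_zero hpos.ne'
  have hle : ⌈(t : ℝ) * (n + 1)⌉₊ ≤ n + 1 := Nat.ceil_le.2 (by
    push_cast
    nlinarith [t.2.2])
  have hkn : k ≤ n := by omega
  refine ⟨k, hkn, ?_, ?_⟩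
  · rw [← Subtype.coe_lt_coe, cellLeft_coe (by omega), div_lt_iff₀ hn]
    exact Nat.lt_ceil.1 (by omega)
  · rw [← Subtype.coe_le_coe, cellLeft_coe (by omega), le_div_iff₀ hn]
    have := Nat.le_ceil ((t : ℝ) * (n + 1))
    rw [hk] at this
    exact_mod_cast this

/-- A left continuous adapted process is predictable. -/
theorem measurable_predictable_of_leftContinuous {𝓗 : Filtration I mS} {Y : I → S → ℝ}
    (had : Adapted 𝓗 Y) (hcont : ∀ x t, ContinuousWithinAt (fun s => Y s x) (Set.Iic t) t) :
    Measurable[𝓗.predictable] (Function.uncurry Y) := by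
  -- Step processes frozen at the left endpoint of each cell. Every summand is supported on a
  -- generator-type set with values known at its left end, hence predictable. Time `0` lies in no
  -- cell and gets its own term.
  let Z : ℕ → I × S → ℝ := fun n z =>
    (({0} : Set I) ×ˢ (Set.univ : Set S)).indicator (fun z => Y 0 z.2) z +
    ∑ k ∈ Finset.range (n + 1),
      (Set.Ioc (cellLeft n k) (cellLeft n (k + 1)) ×ˢ (Set.univ : Set S)).indicator
        (fun z => Y (cellLeft n k) z.2) z
  have hind : ∀ (s : I) (B : Set I), (∀ A, MeasurableSet[𝓗 s] A →
      MeasurableSet[𝓗.predictable] (B ×ˢ A)) → Measurable[𝓗.predictable]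
        ((B ×ˢ (Set.univ : Set S)).indicator (fun z => Y s z.2)) := by
    intro s B hB
    let := 𝓗.predictable
    intro U hU
    have hBu : MeasurableSet (B ×ˢ (Set.univ : Set S)) := hB _ MeasurableSet.univ
    rw [Set.indicator_preimage]
    have h1 : MeasurableSet ((B ×ˢ (Set.univ : Set S)) ∩ (fun z : I × S => Y s z.2) ⁻¹' U) := by
      have : (B ×ˢ (Set.univ : Set S)) ∩ (fun z : I × S => Y s z.2) ⁻¹' U = B ×ˢ (Y s ⁻¹' U) := by
        ext z; simp
      rw [this]
      exact hB _ (had s hU)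
    rw [Set.ite, Set.inter_comm]
    refine h1.union (MeasurableSet.diff ?_ hBu)
    by_cases h0 : (0 : ℝ) ∈ U
    · convert MeasurableSet.univ
      ext z; simp [h0]
    · convert MeasurableSet.empty
      ext z; simp [h0]
  have hZ : ∀ n, Measurable[𝓗.predictable] (Z n) := by
    intro n
    let := 𝓗.predictable
    refine Measurable.add ?_ (Finset.measurable_sum _ fun k _ => ?_)
    · exact hind 0 _ fun A hA => measurableSet_predictable_singleton_bot_prod hA
    · exact hind _ _ fun A hA => measurableSet_predictable_Ioc_prod _ _ hA
  refine @measurable_of_tendsto_metrizable (I × S) ℝ 𝓗.predictable _ _ _ _ Z _ hZ ?_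
  rw [tendsto_pi_nhds]
  rintro ⟨t, x⟩
  by_cases ht : t = 0
  · subst ht
    refine tendsto_const_nhds.congr fun n => ?_
    simp only [Z, Set.indicator, Set.mem_prod, Set.mem_singleton_iff, Set.mem_univ, and_true,
      if_true, Function.uncurry]
    rw [Finset.sum_eq_zero, add_zero]
    intro k _
    rw [if_neg]
    exact fun h => absurd h.1 (not_lt.2 (cellLeft n k).2.1)
  · have hpos : 0 < t := lt_of_le_of_ne t.2.1 (Ne.symm ht)
    choose k hk hkt using fun n => exists_cell n hpos
    have hval : ∀ n, Z n (t, x) = Y (cellLeft n (k n)) x := by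
      intro n
      simp only [Z, Set.indicator, Set.mem_prod, Set.mem_singleton_iff, Set.mem_univ, and_true, ht,
        if_false, zero_add]
      rw [Finset.sum_eq_single (k n), if_pos (hkt n)]
      · intro j hj hjk
        rw [if_neg]
        intro hjt
        have hkn := hk n
        have hj' : j ≤ n := by simpa [Nat.lt_succ_iff] using hj
        have hn : (0 : ℝ) < n + 1 := by positivity
        have a1 := Subtype.coe_lt_coe.2 (hjt.1.trans_le (hkt n).2)
        have a2 := Subtype.coe_lt_coe.2 ((hkt n).1.trans_le hjt.2)
        rw [cellLeft_coe (by omega), cellLeft_coe (by omega),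
          div_lt_div_iff_of_pos_right hn] at a1 a2
        have b1 : j < k n + 1 := by exact_mod_cast a1
        have b2 : k n < j + 1 := by exact_mod_cast a2
        omega
      · intro h
        exact absurd (Finset.mem_range.2 (Nat.lt_succ_of_le (hk n))) h
    refine Tendsto.congr (fun n => (hval n).symm) ?_
    -- The frozen times lie in `[t - 1/(n+1), t)`, so they converge to `t` from the left and left
    -- continuity suffices.
    refine (hcont x t).tendsto.comp (tendsto_nhdsWithin_iff.2 ⟨?_, Eventually.of_forall fun n =>
      (hkt n).1.le⟩)
    rw [tendsto_subtype_rng]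
    refine tendsto_of_tendsto_of_tendsto_of_le_of_le (g := fun n : ℕ => (t : ℝ) - 1 / (n + 1))
      (h := fun _ => (t : ℝ)) ?_ tendsto_const_nhds ?_ fun n => Subtype.coe_le_coe.2 (hkt n).1.le
    · simpa using tendsto_const_nhds.sub (tendsto_one_div_add_atTop_nhds_zero_nat (𝕜 := ℝ))
    · intro n
      have h2 := Subtype.coe_le_coe.2 (hkt n).2
      have hkn := hk n
      rw [cellLeft_coe (by omega)] at h2
      have h3 := cellLeft_coe (n := n) (k := k n) (by omega)
      simp only
      rw [h3]
      push_cast at h2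
      rw [add_div] at h2
      linarith

end

/-! ### Compensators, and exchanging `dN` for the intensity. -/

section

/-- The compensator `∫_0^t ell_s ds`. -/
noncomputable def compensator {S : Type*} (ell : I → S → ℝ) (t : I) (x : S) : ℝ :=
  ∫ s in Set.Ioc 0 t, ell s x

theorem compensator_zero {S : Type*} {ell : I → S → ℝ} (x : S) : compensator ell 0 x = 0 := by
  simp [compensator]

variable {S : Type*} [mS : MeasurableSpace S] {P : Measure S}
  {𝓗 : Filtration I mS} {N : S → StieltjesFunction I} {ell : I → S → ℝ} {C : ℝ}

theorem IsIntensity.measurable_uncurry (h : IsIntensity P 𝓗 N ell) :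
    Measurable fun z : S × I => ell z.2 z.1 :=
  (h.predictable.measurable.mono (predictable_le_prod 𝓗) le_rfl).comp measurable_swap

theorem IsIntensity.measurable_compensator (h : IsIntensity P 𝓗 N ell) (t : I) :
    Measurable (compensator ell t) :=
  (h.measurable_uncurry.stronglyMeasurable.integral_prod_right').measurable

theorem IsIntensity.compensator_nonneg (h : IsIntensity P 𝓗 N ell) (t : I) (x : S) :
    0 ≤ compensator ell t x :=
  integral_nonneg fun s => h.nonneg s x

theorem IsIntensity.ofReal_compensator_sub (h : IsIntensity P 𝓗 N ell) {x : S}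
    (hx : Integrable (fun s => ell s x) volume) {s t : I} (hst : s ≤ t) :
    ENNReal.ofReal (compensator ell t x - compensator ell s x) =
      ∫⁻ u in Set.Ioc s t, ENNReal.ofReal (ell u x) := by
  have h0 : (0 : I) ≤ s := s.2.1
  have : compensator ell t x - compensator ell s x = ∫ u in Set.Ioc s t, ell u x := by
    rw [compensator, compensator, ← Set.Ioc_union_Ioc_eq_Ioc h0 hst,
      setIntegral_union _ measurableSet_Ioc hx.integrableOn hx.integrableOn]
    · ring
    · exact Set.disjoint_left.2 fun u hu hu' => absurd hu.2 (not_le.2 hu'.1)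
  rw [this, ofReal_integral_eq_lintegral_ofReal hx.integrableOn
    (Eventually.of_forall fun u => h.nonneg u x)]

theorem IsIntensity.ofReal_compensator_sub_le (h : IsIntensity P 𝓗 N ell) {x : S}
    (hx : Integrable (fun s => ell s x) volume) (hC : ∀ t, ell t x ≤ C) {s t : I} (hst : s ≤ t) :
    ENNReal.ofReal (compensator ell t x - compensator ell s x) ≤
      ENNReal.ofReal (C * (t - s)) := by
  have hC0 : 0 ≤ C := (h.nonneg 0 x).trans (hC 0)
  rw [h.ofReal_compensator_sub hx hst]
  calc ∫⁻ u in Set.Ioc s t, ENNReal.ofReal (ell u x)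
      ≤ ∫⁻ _ in Set.Ioc s t, ENNReal.ofReal C :=
        lintegral_mono fun u => ENNReal.ofReal_le_ofReal (hC u)
    _ = ENNReal.ofReal (C * (t - s)) := by
        rw [setLIntegral_const, unitInterval.volume_Ioc, ENNReal.ofReal_mul hC0]

theorem IsIntensity.compensator_le (h : IsIntensity P 𝓗 N ell) {x : S}
    (hx : Integrable (fun s => ell s x) volume) (hC : ∀ t, ell t x ≤ C) (t : I) :
    compensator ell t x ≤ C := by
  have hC0 : 0 ≤ C := (h.nonneg 0 x).trans (hC 0)
  have h0 : (0 : I) ≤ t := t.2.1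
  have := h.ofReal_compensator_sub_le hx hC h0
  rw [compensator_zero, sub_zero] at this
  have h2 := (ENNReal.ofReal_le_ofReal_iff (mul_nonneg hC0 (by simpa using t.2.1))).1 this
  have h3 := t.2.2
  have h4 := t.2.1
  simp only [Set.Icc.coe_zero, sub_zero] at h2
  nlinarith

/-- The stopped martingales only take values of `N - ∫ ell` at earlier times of the same path, which
later yields domination. As `1` is the last time, a localizing sequence tending to `⊤` eventually
exceeds it and stops nothing. -/
theorem IsIntensity.exists_stopped (h : IsIntensity P 𝓗 N ell) (hN0 : ∀ x, N x 0 = 0) :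
    ∃ Y : ℕ → I → S → ℝ, (∀ n, Martingale (Y n) 𝓗 P) ∧
      (∀ n t x, ∃ u ≤ t, Y n t x = N x u - compensator ell u x) ∧
      ∀ᵐ x ∂P, ∀ t, ∀ᶠ n in atTop, Y n t x = N x t - compensator ell t x := by
  obtain ⟨τ, hτ, hY⟩ := h.localMartingale
  refine ⟨_, hY, fun n t x => ?_, ?_⟩
  · rw [stoppedProcess_indicator_comm]
    by_cases hx : x ∈ {ω | ⊥ < τ n ω}
    · rw [Set.indicator_of_mem hx]
      rcases le_total (t : WithTop I) (τ n x) with h1 | h1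
      · exact ⟨t, le_rfl, stoppedProcess_eq_of_le h1⟩
      · refine ⟨(τ n x).untopA, ?_, stoppedProcess_eq_of_ge h1⟩
        lift τ n x to I using ne_top_of_le_ne_top WithTop.coe_ne_top h1 with w hw
        simpa using h1
    -- Localization puts the process to `0` where `τ n = ⊥`; this is also its value at time `0`.
    · rw [Set.indicator_of_notMem hx]
      exact ⟨0, t.2.1, by rw [hN0, compensator_zero, sub_zero]⟩
  · filter_upwards [hτ.tendsto_top] with x hx t
    have hev : ∀ᶠ n in atTop, ((1 : I) : WithTop I) < τ n x :=
      hx.eventually (lt_mem_nhds (WithTop.coe_lt_top _))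
    filter_upwards [hev] with n hn
    rw [stoppedProcess_indicator_comm, Set.indicator_of_mem, stoppedProcess_eq_of_le]
    · rfl
    · exact (WithTop.coe_le_coe.2 (show t ≤ 1 from t.2.2)).trans hn.le
    · exact lt_of_le_of_lt bot_le hn

variable [IsProbabilityMeasure P]

/-- The stopped martingales have mean `0` and are at least `-C`. Fatou's lemma applied to `Y n t +
C`, which eventually dominates `N_t`, gives `E N_t ≤ C`. -/
theorem IsIntensity.integrable_counting (h : IsIntensity P 𝓗 N ell) (hN0 : ∀ x, N x 0 = 0)
    (hNm : ∀ t, Measurable fun x => N x t) (hC : ∀ᵐ x ∂P, ∀ t, ell t x ≤ C) (t : I) :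
    Integrable (fun x => N x t) P := by
  obtain ⟨Y, hY, hYM, hlim⟩ := h.exists_stopped hN0
  have hnn : ∀ x t, 0 ≤ N x t := fun x t => by
    rw [← hN0 x]; exact (N x).mono t.2.1
  have hmart : ∀ n, ∫ x, Y n t x ∂P = 0 := by
    intro n
    have h1 := (hY n).setIntegral_eq (i := 0) (j := t) t.2.1 (s := Set.univ) MeasurableSet.univ
    rw [setIntegral_univ, setIntegral_univ] at h1
    rw [← h1]
    refine integral_eq_zero_of_ae (Eventually.of_forall fun x => ?_)
    obtain ⟨u, hu, hu'⟩ := hYM n 0 x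
    have : u = 0 := le_antisymm hu u.2.1
    rw [hu', this, hN0, compensator_zero, sub_zero]; rfl
  have hlow : ∀ n, 0 ≤ᵐ[P] fun x => Y n t x + C := by
    intro n
    filter_upwards [h.integrable, hC] with x hx hCx
    obtain ⟨u, -, hu'⟩ := hYM n t x
    have := h.compensator_le hx hCx u
    have := hnn x u
    simp only [Pi.zero_apply]
    linarith
  have hint : ∀ n, ∫⁻ x, ENNReal.ofReal (Y n t x + C) ∂P = ENNReal.ofReal C := by
    intro n
    have hi : Integrable (fun x => Y n t x + C) P := ((hY n).integrable t).add (integrable_const C)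
    rw [← ofReal_integral_eq_lintegral_ofReal hi
      (hlow n), integral_add ((hY n).integrable t) (integrable_const C), hmart]
    simp
  have hfatou : ∫⁻ x, ENNReal.ofReal (N x t) ∂P ≤ ENNReal.ofReal C := by
    calc ∫⁻ x, ENNReal.ofReal (N x t) ∂P
        ≤ ∫⁻ x, liminf (fun n => ENNReal.ofReal (Y n t x + C)) atTop ∂P := by
          refine lintegral_mono_ae ?_
          filter_upwards [h.integrable, hC, hlim] with x hx hCx hl
          refine le_liminf_of_le (by isBoundedDefault) ?_
          filter_upwards [hl t] with n hn
          rw [hn]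
          have := h.compensator_le hx hCx t
          exact ENNReal.ofReal_le_ofReal (by linarith)
      _ ≤ liminf (fun n => ∫⁻ x, ENNReal.ofReal (Y n t x + C) ∂P) atTop :=
          lintegral_liminf_le' fun n =>
            (((hY n).integrable t).aestronglyMeasurable.aemeasurable.add_const C).ennreal_ofReal
      _ = ENNReal.ofReal C := by simp [hint]
  refine ⟨(hNm t).aestronglyMeasurable, ?_⟩
  rw [hasFiniteIntegral_iff_ofReal (Eventually.of_forall fun x => hnn x t)]
  exact hfatou.trans_lt ENNReal.ofReal_lt_top

theorem IsIntensity.integrable_compensator (h : IsIntensity P 𝓗 N ell)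
    (hC : ∀ᵐ x ∂P, ∀ t, ell t x ≤ C) (t : I) : Integrable (compensator ell t) P := by
  refine Integrable.of_bound (h.measurable_compensator t).aestronglyMeasurable C ?_
  filter_upwards [h.integrable, hC] with x hx hCx
  rw [Real.norm_of_nonneg (h.compensator_nonneg t x)]
  exact h.compensator_le hx hCx t

/-- The local martingale is a true one: a stopped value at time `r` is `N_u - ∫_0^u ell` for some `u
≤ r`, hence at most `N_r + C` in absolute value, and dominated convergence removes the stopping. -/
theorem IsIntensity.setIntegral_eq (h : IsIntensity P 𝓗 N ell) (hN0 : ∀ x, N x 0 = 0)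
    (hNm : ∀ t, Measurable fun x => N x t) (hC : ∀ᵐ x ∂P, ∀ t, ell t x ≤ C) {s t : I}
    (hst : s ≤ t) {A : Set S} (hA : MeasurableSet[𝓗 s] A) :
    ∫ x in A, (N x s - compensator ell s x) ∂P = ∫ x in A, (N x t - compensator ell t x) ∂P := by
  obtain ⟨Y, hY, hYM, hlim⟩ := h.exists_stopped hN0
  have hnn : ∀ x t, 0 ≤ N x t := fun x t => by
    rw [← hN0 x]; exact (N x).mono t.2.1
  have key : ∀ r, Tendsto (fun n => ∫ x in A, Y n r x ∂P) atTop
      (𝓝 (∫ x in A, (N x r - compensator ell r x) ∂P)) := by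
    intro r
    refine tendsto_integral_of_dominated_convergence (fun x => N x r + C)
      (fun n => ((hY n).integrable r).aestronglyMeasurable.restrict)
      (((h.integrable_counting hN0 hNm hC r).add (integrable_const C)).integrableOn)
      (fun n => ae_restrict_of_ae ?_) (ae_restrict_of_ae ?_)
    · filter_upwards [h.integrable, hC] with x hx hCx
      obtain ⟨u, hur, hu⟩ := hYM n r x
      have h1 := h.compensator_le hx hCx u
      have h2 := h.compensator_nonneg u x
      have h3 := (N x).mono hur
      have h4 := hnn x u
      rw [hu, Real.norm_eq_abs, abs_le]
      constructor <;> linarith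
    · filter_upwards [hlim] with x hl
      exact tendsto_const_nhds.congr' ((hl r).mono fun n hn => hn.symm)
  refine tendsto_nhds_unique (key s) ((key t).congr fun n => ?_)
  exact ((hY n).setIntegral_eq hst hA).symm

/-- The martingale property between `s` and `1`, rewritten as equality of the two measures on the
generators `(s,1] × A` of the predictable σ-algebra. -/
theorem IsIntensity.setLIntegral_eq (h : IsIntensity P 𝓗 N ell) (hN0 : ∀ x, N x 0 = 0)
    (hNm : ∀ t, Measurable fun x => N x t) (hC : ∀ᵐ x ∂P, ∀ t, ell t x ≤ C) (s : I)
    {A : Set S} (hA : MeasurableSet[𝓗 s] A) :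
    ∫⁻ x in A, (N x).measure (Set.Ioi s) ∂P =
      ∫⁻ x in A, ∫⁻ u in Set.Ioi s, ENNReal.ofReal (ell u x) ∂volume ∂P := by
  have hs1 : s ≤ 1 := s.2.2
  have hIoi : Set.Ioi s = Set.Ioc s 1 := by
    ext u; simp only [Set.mem_Ioi, Set.mem_Ioc]; exact ⟨fun hu => ⟨hu, u.2.2⟩, fun hu => hu.1⟩
  have hiN := h.integrable_counting hN0 hNm hC
  have hiL := h.integrable_compensator hC
  have h1 := h.setIntegral_eq hN0 hNm hC hs1 hA
  have e1 : ∀ t, ∫ x in A, (N x t - compensator ell t x) ∂P =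
      ∫ x in A, N x t ∂P - ∫ x in A, compensator ell t x ∂P := fun t =>
    integral_sub (hiN t).integrableOn (hiL t).integrableOn
  rw [e1, e1] at h1
  have h2 : ∫ x in A, (N x 1 - N x s) ∂P =
      ∫ x in A, (compensator ell 1 x - compensator ell s x) ∂P := by
    rw [integral_sub (hiN 1).integrableOn (hiN s).integrableOn,
      integral_sub (hiL 1).integrableOn (hiL s).integrableOn]
    linarith
  have h3 : ∀ᵐ x ∂P, 0 ≤ compensator ell 1 x - compensator ell s x := by
    filter_upwards [h.integrable] with x hx
    refine sub_nonneg.2 (setIntegral_mono_set hx.integrableOn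
      (Eventually.of_forall fun u => h.nonneg u x) ?_)
    exact (Set.Ioc_subset_Ioc_right hs1).eventuallyLE
  calc ∫⁻ x in A, (N x).measure (Set.Ioi s) ∂P
      = ∫⁻ x in A, ENNReal.ofReal (N x 1 - N x s) ∂P := by simp [hIoi]
    _ = ENNReal.ofReal (∫ x in A, (N x 1 - N x s) ∂P) :=
        (ofReal_integral_eq_lintegral_ofReal ((hiN 1).sub (hiN s)).integrableOn
          (Eventually.of_forall fun x => sub_nonneg.2 ((N x).mono hs1))).symm
    _ = ENNReal.ofReal (∫ x in A, (compensator ell 1 x - compensator ell s x) ∂P) := by rw [h2]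
    _ = ∫⁻ x in A, ENNReal.ofReal (compensator ell 1 x - compensator ell s x) ∂P :=
        ofReal_integral_eq_lintegral_ofReal ((hiL 1).sub (hiL s)).integrableOn
          (ae_restrict_of_ae h3)
    _ = ∫⁻ x in A, ∫⁻ u in Set.Ioi s, ENNReal.ofReal (ell u x) ∂volume ∂P := by
        refine lintegral_congr_ae (ae_restrict_of_ae ?_)
        filter_upwards [h.integrable] with x hx
        rw [h.ofReal_compensator_sub hx hs1, hIoi]

theorem isPiSystem_predictable (𝓗 : Filtration I mS) :
    IsPiSystem ({s : Set (I × S) | ∃ A, MeasurableSet[𝓗 ⊥] A ∧ s = {⊥} ×ˢ A} ∪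
      {s | ∃ i A, MeasurableSet[𝓗 i] A ∧ s = Set.Ioi i ×ˢ A}) := by
  rintro _ (⟨A, hA, rfl⟩ | ⟨i, A, hA, rfl⟩) _ (⟨B, hB, rfl⟩ | ⟨j, B, hB, rfl⟩) hne
  · refine Or.inl ⟨A ∩ B, hA.inter hB, ?_⟩
    rw [Set.prod_inter_prod, Set.inter_self]
  · obtain ⟨z, hz1, hz2⟩ := hne
    have : z.1 = ⊥ := hz1.1
    exact absurd hz2.1 (by rw [this]; simp)
  · obtain ⟨z, hz1, hz2⟩ := hne
    have : z.1 = ⊥ := hz2.1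
    exact absurd hz1.1 (by rw [this]; simp)
  · refine Or.inr ⟨i ⊔ j, A ∩ B,
      (𝓗.mono le_sup_left _ hA).inter (𝓗.mono le_sup_right _ hB), ?_⟩
    rw [Set.prod_inter_prod, Set.Ioi_inter_Ioi]

/-- The integral of a nonnegative predictable process with respect to a counting process has the
same expectation as its integral with respect to the compensator. -/
theorem IsIntensity.lintegral_eq (h : IsIntensity P 𝓗 N ell) (hN0 : ∀ x, N x 0 = 0)
    (hNm : ∀ t, Measurable fun x => N x t) (hC : ∀ᵐ x ∂P, ∀ t, ell t x ≤ C)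
    {H : I × S → ℝ≥0∞} (hH : Measurable[𝓗.predictable] H) :
    ∫⁻ x, ∫⁻ s, H (s, x) ∂(N x).measure ∂P =
      ∫⁻ x, ∫⁻ s, H (s, x) * ENNReal.ofReal (ell s x) ∂volume ∂P := by
  have hle := predictable_le_prod 𝓗
  have hm : Measurable fun z : S × I => ENNReal.ofReal (ell z.2 z.1) :=
    h.measurable_uncurry.ennreal_ofReal
  -- `α` is `P(dx) N(x)(ds)` and `β` is `P(dx) ell_s(x) ds`. The claim is that they agree on
  -- predictable sets.
  set α : Measure (I × S) := (P ⊗ₘ stieltjesKernel N hNm).map Prod.swap with hα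
  set β : Measure (I × S) :=
    ((P.prod volume).withDensity fun z : S × I => ENNReal.ofReal (ell z.2 z.1)).map Prod.swap
    with hβ
  have hαi : ∀ F : I × S → ℝ≥0∞, Measurable F →
      ∫⁻ z, F z ∂α = ∫⁻ x, ∫⁻ s, F (s, x) ∂(N x).measure ∂P := by
    intro F hF
    have hF' : Measurable fun z : S × I => F z.swap := hF.comp measurable_swap
    rw [hα, lintegral_map hF measurable_swap, Measure.lintegral_compProd hF']
    rfl
  have hβi : ∀ F : I × S → ℝ≥0∞, Measurable F →
      ∫⁻ z, F z ∂β = ∫⁻ x, ∫⁻ s, F (s, x) * ENNReal.ofReal (ell s x) ∂volume ∂P := by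
    intro F hF
    have hF' : Measurable fun z : S × I => F z.swap := hF.comp measurable_swap
    rw [hβ, lintegral_map hF measurable_swap, lintegral_withDensity_eq_lintegral_mul _ hm hF',
      lintegral_prod _ (hm.mul hF').aemeasurable]
    simp [mul_comm]
  have hrect : ∀ (B : Set I) (A : Set S), MeasurableSet B → MeasurableSet A →
      α (B ×ˢ A) = ∫⁻ x in A, (N x).measure B ∂P ∧
      β (B ×ˢ A) = ∫⁻ x in A, ∫⁻ u in B, ENNReal.ofReal (ell u x) ∂volume ∂P := by
    intro B A hB hA
    have hBA := hB.prod hA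
    have h1 : Measurable ((B ×ˢ A).indicator (fun _ => (1 : ℝ≥0∞))) :=
      measurable_const.indicator hBA
    have hpt : ∀ s x, (B ×ˢ A).indicator (fun _ => (1 : ℝ≥0∞)) (s, x) =
        A.indicator (fun _ => B.indicator (fun _ => 1) s) x := by
      intro s x
      by_cases hs : s ∈ B <;> by_cases hx : x ∈ A <;> simp [hs, hx]
    constructor
    · rw [← setLIntegral_one, ← lintegral_indicator hBA, hαi _ h1, ← lintegral_indicator hA]
      refine lintegral_congr fun x => ?_
      simp only [hpt]
      by_cases hx : x ∈ A <;> simp [hx, lintegral_indicator hB]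
    · rw [← setLIntegral_one, ← lintegral_indicator hBA, hβi _ h1, ← lintegral_indicator hA]
      refine lintegral_congr fun x => ?_
      by_cases hx : x ∈ A
      · simp only [hpt, hx, Set.indicator_of_mem]
        rw [← lintegral_indicator hB]
        refine lintegral_congr fun s => ?_
        by_cases hs : s ∈ B <;> simp [hs]
      · simp [hx]
  have hbot : ∀ A, MeasurableSet A → α ({0} ×ˢ A) = β ({0} ×ˢ A) := by
    intro A hA
    obtain ⟨h1, h2⟩ := hrect {0} A (measurableSet_singleton _) hA
    rw [h1, h2]
    simp only [stieltjes_measure_singleton_zero]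
    simp [Measure.restrict_singleton]
  have hIoi : ∀ s A, MeasurableSet[𝓗 s] A → α (Set.Ioi s ×ˢ A) = β (Set.Ioi s ×ˢ A) := by
    intro s A hA
    obtain ⟨h1, h2⟩ := hrect (Set.Ioi s) A measurableSet_Ioi (𝓗.le _ _ hA)
    rw [h1, h2, h.setLIntegral_eq hN0 hNm hC s hA]
  have hαfin : IsFiniteMeasure α := by
    refine ⟨?_⟩
    rw [← Set.univ_prod_univ, (hrect _ _ MeasurableSet.univ MeasurableSet.univ).1]
    simp only [stieltjes_measure_univ, hN0, sub_zero, Measure.restrict_univ]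
    exact (h.integrable_counting hN0 hNm hC 1).lintegral_lt_top
  have huniv : α Set.univ = β Set.univ := by
    have : (Set.univ : Set (I × S)) = ({0} ×ˢ Set.univ) ∪ (Set.Ioi 0 ×ˢ Set.univ) := by
      ext ⟨s, x⟩
      simp only [Set.mem_univ, Set.mem_union, Set.mem_prod, Set.mem_singleton_iff, Set.mem_Ioi,
        and_true, true_iff]
      exact (eq_or_lt_of_le (show (0 : I) ≤ s from s.2.1)).imp Eq.symm id
    have hd : Disjoint (({0} : Set I) ×ˢ (Set.univ : Set S)) (Set.Ioi 0 ×ˢ Set.univ) :=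
      Set.disjoint_left.2 fun z h1 h2 => absurd h2.1 (by
        have : z.1 = 0 := h1.1
        rw [this]; simp)
    have hms : MeasurableSet (Set.Ioi (0 : I) ×ˢ (Set.univ : Set S)) :=
      measurableSet_Ioi.prod MeasurableSet.univ
    rw [this, measure_union hd hms, measure_union hd hms, hbot _ MeasurableSet.univ,
      hIoi 0 _ MeasurableSet.univ]
  have hαtrim : IsFiniteMeasure (α.trim hle) := isFiniteMeasure_trim hle
  -- Agreement holds only on the predictable σ-algebra, so uniqueness from the generating π-system
  -- is applied to the trimmed measures; it needs a finite total mass, here `E N_1`.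
  have htrim : α.trim hle = β.trim hle := by
    refine @ext_of_generate_finite _ 𝓗.predictable _ _ _ rfl (isPiSystem_predictable 𝓗) hαtrim ?_ ?_
    · intro s hs
      have hs' : MeasurableSet[𝓗.predictable] s := MeasurableSpace.measurableSet_generateFrom hs
      rw [trim_measurableSet_eq hle hs', trim_measurableSet_eq hle hs']
      rcases hs with ⟨A, hA, rfl⟩ | ⟨i, A, hA, rfl⟩
      · exact hbot A (𝓗.le _ _ hA)
      · exact hIoi i A hA
    · rw [trim_measurableSet_eq hle (@MeasurableSet.univ _ 𝓗.predictable),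
        trim_measurableSet_eq hle (@MeasurableSet.univ _ 𝓗.predictable), huniv]
  have hH' : Measurable H := hH.mono hle le_rfl
  rw [← hαi H hH', ← hβi H hH', ← lintegral_trim hle hH, ← lintegral_trim hle hH, htrim]

end

/-! ### Moment bounds for counting processes with bounded intensity. -/

section

/-- Measure-theoretic form of `N_1² = 2 ∫ N_{s-} dN_s + N_1`. The square `I × I` splits into the two
open triangles, which have equal mass, and the diagonal, whose mass is the sum of squared atoms and
so is controlled by atoms of size at most one. -/
theorem sq_measure_univ_le (κ : Measure I) [IsFiniteMeasure κ] (hatom : ∀ r, κ {r} ≤ 1) :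
    κ Set.univ ^ 2 ≤ 2 * ∫⁻ r, κ (Set.Iio r) ∂κ + κ Set.univ := by
  have hlt : MeasurableSet {z : I × I | z.1 < z.2} := measurableSet_lt measurable_fst measurable_snd
  have hgt : MeasurableSet {z : I × I | z.2 < z.1} := measurableSet_lt measurable_snd measurable_fst
  have heq : MeasurableSet {z : I × I | z.1 = z.2} :=
    measurableSet_eq_fun measurable_fst measurable_snd
  have h1 : (κ.prod κ) {z : I × I | z.1 < z.2} = ∫⁻ r, κ (Set.Iio r) ∂κ := by
    rw [Measure.prod_apply_symm hlt]; rfl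
  have h2 : (κ.prod κ) {z : I × I | z.2 < z.1} = ∫⁻ r, κ (Set.Iio r) ∂κ := by
    rw [Measure.prod_apply hgt]; rfl
  have h3 : (κ.prod κ) {z : I × I | z.1 = z.2} ≤ κ Set.univ := by
    rw [Measure.prod_apply heq]
    calc ∫⁻ r, κ (Prod.mk r ⁻¹' {z : I × I | z.1 = z.2}) ∂κ ≤ ∫⁻ _, 1 ∂κ := by
          refine lintegral_mono fun r => ?_
          convert hatom r
          ext s; simp [eq_comm]
      _ = κ Set.univ := by simp
  calc κ Set.univ ^ 2 = (κ.prod κ) Set.univ := by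
        rw [← Set.univ_prod_univ, Measure.prod_prod, sq]
    _ ≤ (κ.prod κ) ({z : I × I | z.1 < z.2} ∪ {z : I × I | z.2 < z.1} ∪
          {z : I × I | z.1 = z.2}) := by
        refine measure_mono fun z _ => ?_
        rcases lt_trichotomy z.1 z.2 with h | h | h
        · exact Or.inl (Or.inl h)
        · exact Or.inr h
        · exact Or.inl (Or.inr h)
    _ ≤ ((κ.prod κ) {z : I × I | z.1 < z.2} + (κ.prod κ) {z : I × I | z.2 < z.1}) +
          (κ.prod κ) {z : I × I | z.1 = z.2} :=
        (measure_union_le _ _).trans (add_le_add_left (measure_union_le _ _) _)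
    _ ≤ (∫⁻ r, κ (Set.Iio r) ∂κ + ∫⁻ r, κ (Set.Iio r) ∂κ) + κ Set.univ := by
        rw [h1, h2]; gcongr
    _ = 2 * ∫⁻ r, κ (Set.Iio r) ∂κ + κ Set.univ := by rw [two_mul]

/-- The left limit `N_{r-}`, as a countable supremum of simple predictable processes. -/
noncomputable def leftCount {S : Type*} (N : S → StieltjesFunction I) (z : I × S) : ℝ≥0∞ :=
  ⨆ n, (Set.Ioi (TopologicalSpace.denseSeq I n) ×ˢ Set.univ).indicator
    (fun z : I × S => ENNReal.ofReal (N z.2 (TopologicalSpace.denseSeq I n))) z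

theorem leftCount_le {S : Type*} {N : S → StieltjesFunction I} (z : I × S) :
    leftCount N z ≤ ENNReal.ofReal (N z.2 1) := by
  refine iSup_le fun n => ?_
  refine (Set.indicator_le_self _ _ z).trans ?_
  exact ENNReal.ofReal_le_ofReal ((N z.2).mono (TopologicalSpace.denseSeq I n).2.2)

/-- `[0,r)` is exhausted by the directed countable family `[0,q]` with `q < r` in a dense sequence.
Replacing the left limit by this supremum makes predictability evident. -/
theorem measure_Iio_le_leftCount {S : Type*} {N : S → StieltjesFunction I} (hN0 : ∀ x, N x 0 = 0)
    (r : I) (x : S) : (N x).measure (Set.Iio r) ≤ leftCount N (r, x) := by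
  have hsub : Set.Iio r ⊆ ⋃ n : {n // TopologicalSpace.denseSeq I n < r},
      Set.Iic (TopologicalSpace.denseSeq I n.1) := by
    intro s hs
    obtain ⟨q, ⟨hq1, hq2⟩, n, rfl⟩ := (TopologicalSpace.denseRange_denseSeq I).inter_open_nonempty
      (Set.Ioo s r) isOpen_Ioo (Set.nonempty_Ioo.2 hs)
    exact Set.mem_iUnion.2 ⟨⟨n, hq2⟩, hq1.le⟩
  refine (measure_mono hsub).trans ?_
  rw [Directed.measure_iUnion]
  · refine iSup_le fun n => ?_
    rw [stieltjes_measure_Iic, hN0, sub_zero]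
    refine le_iSup_of_le n.1 ?_
    rw [Set.indicator_of_mem]
    exact ⟨n.2, trivial⟩
  · intro a b
    rcases le_total (TopologicalSpace.denseSeq I a.1) (TopologicalSpace.denseSeq I b.1) with h | h
    · exact ⟨b, Set.Iic_subset_Iic.2 h, le_rfl⟩
    · exact ⟨a, le_rfl, Set.Iic_subset_Iic.2 h⟩

theorem measurable_leftCount {S : Type*} [mS : MeasurableSpace S] {𝓗 : Filtration I mS}
    {N : S → StieltjesFunction I} (had : Adapted 𝓗 fun t x => N x t) :
    Measurable[𝓗.predictable] (leftCount N) := by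
  let := 𝓗.predictable
  refine Measurable.iSup fun n => ?_
  set q := TopologicalSpace.denseSeq I n
  refine measurable_of_Ioi fun a => ?_
  -- The values lie in `[0,∞]`, so the value `0` off the support never exceeds `a` and the preimage
  -- is a single generating rectangle.
  have : (Set.Ioi q ×ˢ Set.univ).indicator (fun z : I × S => ENNReal.ofReal (N z.2 q)) ⁻¹'
      Set.Ioi a = Set.Ioi q ×ˢ {x | a < ENNReal.ofReal (N x q)} := by
    ext ⟨r, x⟩
    by_cases hr : q < r <;> simp [Set.indicator, hr]
  rw [this]
  exact measurableSet_predictable_Ioi_prod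
    (measurableSet_Ioi.preimage (ENNReal.measurable_ofReal.comp (had q)))

variable {S : Type*} [mS : MeasurableSpace S] {P : Measure S} [IsProbabilityMeasure P]
  {𝓗 : Filtration I mS} {N : S → StieltjesFunction I} {ell : I → S → ℝ} {C : ℝ}

theorem IsIntensity.lintegral_le (h : IsIntensity P 𝓗 N ell) (hN0 : ∀ x, N x 0 = 0)
    (hNm : ∀ t, Measurable fun x => N x t) (hC : ∀ᵐ x ∂P, ∀ t, ell t x ≤ C)
    {H : I × S → ℝ≥0∞} (hH : Measurable[𝓗.predictable] H) :
    ∫⁻ x, ∫⁻ s, H (s, x) ∂(N x).measure ∂P ≤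
      ENNReal.ofReal C * ∫⁻ x, ∫⁻ s, H (s, x) ∂volume ∂P := by
  rw [h.lintegral_eq hN0 hNm hC hH]
  have hH' : Measurable fun z : S × I => H (z.2, z.1) :=
    (hH.mono (predictable_le_prod 𝓗) le_rfl).comp measurable_swap
  rw [← lintegral_const_mul _ hH'.lintegral_prod_right']
  refine lintegral_mono_ae ?_
  filter_upwards [hC] with x hx
  have hHx : Measurable fun s => H (s, x) := hH'.comp (measurable_prodMk_left (x := x))
  rw [← lintegral_const_mul _ hHx]
  refine lintegral_mono fun s => ?_
  rw [mul_comm]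
  gcongr
  exact hx s

theorem IsIntensity.lintegral_measure_le (h : IsIntensity P 𝓗 N ell) (hN0 : ∀ x, N x 0 = 0)
    (hNm : ∀ t, Measurable fun x => N x t) (hC : ∀ᵐ x ∂P, ∀ t, ell t x ≤ C) {s t : I}
    (hst : s ≤ t) :
    ∫⁻ x, (N x).measure (Set.Ioc s t) ∂P ≤ ENNReal.ofReal (C * (t - s)) := by
  have hset : MeasurableSet[𝓗.predictable] (Set.Ioc s t ×ˢ (Set.univ : Set S)) :=
    measurableSet_predictable_Ioc_prod s t MeasurableSet.univ
  have h1 := h.lintegral_le hN0 hNm hC (H := (Set.Ioc s t ×ˢ Set.univ).indicator 1)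
    (Measurable.indicator (@measurable_const _ _ _ 𝓗.predictable 1) hset)
  have hpt : ∀ x : S, (fun u : I => (Set.Ioc s t ×ˢ (Set.univ : Set S)).indicator
      (1 : I × S → ℝ≥0∞) (u, x)) = (Set.Ioc s t).indicator 1 := by
    intro x
    ext u
    by_cases hu : u ∈ Set.Ioc s t
    · have hux : (u, x) ∈ Set.Ioc s t ×ˢ (Set.univ : Set S) := ⟨hu, trivial⟩
      rw [Set.indicator_of_mem hu, Set.indicator_of_mem hux]
      rfl
    · rw [Set.indicator_of_notMem hu, Set.indicator_of_notMem]
      exact fun h => hu h.1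
  simp only [hpt, lintegral_indicator_one measurableSet_Ioc, unitInterval.volume_Ioc,
    lintegral_const, measure_univ, mul_one] at h1
  refine h1.trans ?_
  rw [ENNReal.ofReal_mul' (sub_nonneg.2 (Subtype.coe_le_coe.2 hst))]

theorem IsIntensity.lintegral_measure_univ_le (h : IsIntensity P 𝓗 N ell) (hN0 : ∀ x, N x 0 = 0)
    (hNm : ∀ t, Measurable fun x => N x t) (hC : ∀ᵐ x ∂P, ∀ t, ell t x ≤ C) :
    ∫⁻ x, (N x).measure Set.univ ∂P ≤ ENNReal.ofReal C := by
  have h1 := h.lintegral_measure_le hN0 hNm hC (s := 0) (t := 1) zero_le_one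
  simpa [stieltjes_measure_univ] using h1

/-- The second moment of a counting process is bounded if its intensity is. -/
theorem IsIntensity.lintegral_sq_measure_univ_le (h : IsIntensity P 𝓗 N ell)
    (hN : ∀ x, IsCountingPath (N x)) (had : Adapted 𝓗 fun t x => N x t)
    (hC : ∀ᵐ x ∂P, ∀ t, ell t x ≤ C) :
    ∫⁻ x, (N x).measure Set.univ ^ 2 ∂P ≤
      2 * (ENNReal.ofReal C * ENNReal.ofReal C) + ENNReal.ofReal C := by
  have hN0 : ∀ x, N x 0 = 0 := fun x => (hN x).zero
  have hNm : ∀ t, Measurable fun x => N x t := fun t => (had t).mono (𝓗.le t) le_rfl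
  have hmass : ∀ x, (N x).measure Set.univ = ENNReal.ofReal (N x 1) := fun x => by
    rw [stieltjes_measure_univ, hN0, sub_zero]
  have hE := h.lintegral_measure_univ_le hN0 hNm hC
  have hmeas : Measurable fun x => (N x).measure Set.univ := by
    simp only [hmass]; exact (hNm 1).ennreal_ofReal
  calc ∫⁻ x, (N x).measure Set.univ ^ 2 ∂P
      ≤ ∫⁻ x, (2 * ∫⁻ s, leftCount N (s, x) ∂(N x).measure + (N x).measure Set.univ) ∂P := by
        refine lintegral_mono fun x => (sq_measure_univ_le _ fun r => ?_).trans ?_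
        · rw [StieltjesFunction.measure_singleton]
          exact ENNReal.ofReal_le_one.2 ((hN x).jump r)
        · gcongr with r
          exact measure_Iio_le_leftCount hN0 r x
    _ = 2 * ∫⁻ x, ∫⁻ s, leftCount N (s, x) ∂(N x).measure ∂P +
          ∫⁻ x, (N x).measure Set.univ ∂P := by
        rw [lintegral_add_right _ hmeas, lintegral_const_mul' _ _ (by simp)]
    _ ≤ 2 * (ENNReal.ofReal C * ENNReal.ofReal C) + ENNReal.ofReal C := by
        gcongr
        -- `E ∫ N_{s-} dN_s ≤ C E ∫ N_{s-} ds ≤ C E N_1 ≤ C²`; predictability of the left limit is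
        -- what permits the first step.
        refine (h.lintegral_le hN0 hNm hC (measurable_leftCount had)).trans ?_
        gcongr
        refine le_trans (lintegral_mono fun x => ?_) hE
        calc ∫⁻ s, leftCount N (s, x) ∂volume ≤ ∫⁻ _ : I, (N x).measure Set.univ ∂volume :=
              lintegral_mono fun s => (hmass x).symm ▸ leftCount_le (s, x)
          _ = (N x).measure Set.univ := by simp

end

/-! ### Deterministic and i.i.d. tools: grid comparison and Chebyshev's inequality. -/

/-- Monotone functions that are close on a fine grid are uniformly close. -/
theorem abs_sub_le_of_grid {a v : I → ℝ} (ha : Monotone a) (hv : Monotone v) {L δ : ℝ} {m : ℕ}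
    (hδ : 0 ≤ δ) (hL : ∀ s t : I, s ≤ t → v t - v s ≤ L * (t - s)) (hm : L ≤ δ * (m + 1))
    (hgrid : ∀ k ≤ m + 1, |a (cellLeft m k) - v (cellLeft m k)| ≤ δ) (t : I) :
    |a t - v t| ≤ 2 * δ := by
  rcases eq_or_lt_of_le (show (0 : I) ≤ t from t.2.1) with h0 | hpos
  · have hc : cellLeft m 0 = 0 := Subtype.ext (by rw [cellLeft_coe (by omega)]; simp)
    have := hgrid 0 (by omega)
    rw [hc, h0] at this
    linarith
  · obtain ⟨k, hk, hk1, hk2⟩ := exists_cell m hpos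
    have hn : (0 : ℝ) < m + 1 := by positivity
    have g1 := abs_le.1 (hgrid k (by omega))
    have g2 := abs_le.1 (hgrid (k + 1) (by omega))
    -- Over one cell of length `1/(m+1)` the function `v` grows by at most `L/(m+1) ≤ δ`. Together
    -- with the grid error `δ` and monotonicity this gives `2δ`.
    have hvv : v (cellLeft m (k + 1)) - v (cellLeft m k) ≤ δ := by
      refine (hL _ _ (hk1.le.trans hk2)).trans ?_
      rw [cellLeft_coe (by omega), cellLeft_coe (by omega), ← sub_div]
      push_cast
      rw [add_sub_cancel_left, mul_one_div, div_le_iff₀ hn]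
      exact hm
    have a1 := ha hk1.le
    have a2 := ha hk2
    have v1 := hv hk1.le
    have v2 := hv hk2
    rw [abs_le]
    constructor <;> linarith

/-- Chebyshev's inequality for the average of a function over part of an i.i.d. sample. -/
theorem measure_average_deviation_le {Ω S : Type*} [MeasurableSpace Ω] [MeasurableSpace S]
    {μ : Measure Ω} [IsProbabilityMeasure μ] {P : Measure S} [IsProbabilityMeasure P]
    {ξ : ℕ → Ω → S} (hξ : ∀ j, Measurable (ξ j)) (hlaw : ∀ j, μ.map (ξ j) = P)
    (hindep : iIndepFun ξ μ) {F : S → ℝ} (hF : Measurable F) (hF2 : MemLp F 2 P) {K : ℝ}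
    (hK : ∫ x, F x ^ 2 ∂P ≤ K) (s : Finset ℕ) (hs : 0 < s.card) {δ : ℝ} (hδ : 0 < δ) :
    μ {ω | δ ≤ |(s.card : ℝ)⁻¹ * ∑ j ∈ s, F (ξ j ω) - ∫ x, F x ∂P|} ≤
      ENNReal.ofReal (K / (s.card * δ ^ 2)) := by
  have hc : (0 : ℝ) < s.card := by exact_mod_cast hs
  have hmp : ∀ j, MeasurePreserving (ξ j) μ P := fun j => ⟨hξ j, hlaw j⟩
  have hL : ∀ j, MemLp (fun ω => F (ξ j ω)) 2 μ := fun j => hF2.comp_measurePreserving (hmp j)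
  have hint : ∀ j, ∫ ω, F (ξ j ω) ∂μ = ∫ x, F x ∂P := fun j => by
    rw [← hlaw j, integral_map (hξ j).aemeasurable hF.aestronglyMeasurable]
  have hint2 : ∀ j, ∫ ω, F (ξ j ω) ^ 2 ∂μ = ∫ x, F x ^ 2 ∂P := fun j => by
    rw [← hlaw j, integral_map (hξ j).aemeasurable (hF.pow_const 2).aestronglyMeasurable]
  have hsum : MemLp (∑ j ∈ s, fun ω => F (ξ j ω)) 2 μ := memLp_finsetSum' _ fun j _ => hL j
  have hvar : Var[∑ j ∈ s, fun ω => F (ξ j ω); μ] ≤ s.card * K := by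
    rw [IndepFun.variance_sum (fun j _ => hL j)
      (fun i _ j _ hij => (hindep.indepFun hij).comp hF hF)]
    calc ∑ j ∈ s, Var[fun ω => F (ξ j ω); μ] ≤ ∑ _j ∈ s, K := by
          refine Finset.sum_le_sum fun j _ => ?_
          refine (variance_le_expectation_sq (hL j).aestronglyMeasurable).trans ?_
          exact (hint2 j).le.trans hK
      _ = s.card * K := by simp
  have hmean : ∫ ω, (∑ j ∈ s, fun ω => F (ξ j ω)) ω ∂μ = s.card * ∫ x, F x ∂P := by
    simp only [Finset.sum_apply]
    rw [integral_finsetSum _ fun j _ => (hL j).integrable (by norm_num)]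
    simp [hint]
  calc μ {ω | δ ≤ |(s.card : ℝ)⁻¹ * ∑ j ∈ s, F (ξ j ω) - ∫ x, F x ∂P|}
      ≤ μ {ω | s.card * δ ≤ |(∑ j ∈ s, fun ω => F (ξ j ω)) ω -
          ∫ ω, (∑ j ∈ s, fun ω => F (ξ j ω)) ω ∂μ|} := by
        refine measure_mono fun ω hω => ?_
        simp only [Set.mem_ofPred_eq] at hω ⊢
        rw [hmean, Finset.sum_apply]
        have : ∑ j ∈ s, F (ξ j ω) - s.card * ∫ x, F x ∂P =
            s.card * ((s.card : ℝ)⁻¹ * ∑ j ∈ s, F (ξ j ω) - ∫ x, F x ∂P) := by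
          field_simp
        rw [this, abs_mul, abs_of_pos hc]
        gcongr
    _ ≤ ENNReal.ofReal (Var[∑ j ∈ s, fun ω => F (ξ j ω); μ] / (s.card * δ) ^ 2) :=
        meas_ge_le_variance_div_sq hsum (by positivity)
    _ ≤ ENNReal.ofReal (K / (s.card * δ ^ 2)) := by
        refine ENNReal.ofReal_le_ofReal ?_
        rw [div_le_div_iff₀ (by positivity) (by positivity)]
        calc _ ≤ (s.card * K) * (s.card * δ ^ 2) := by gcongr
          _ = _ := by ring

theorem integrable_sq_of_abs_le {κ : Measure I} [IsFiniteMeasure κ] {f : I → ℝ}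
    (hf : Measurable f) {c : ℝ} (hc : ∀ t, |f t| ≤ c) : Integrable (fun t => f t ^ 2) κ :=
  Integrable.of_bound (hf.pow_const 2).aestronglyMeasurable (c ^ 2)
    (Eventually.of_forall fun t => by
      rw [Real.norm_of_nonneg (sq_nonneg _), ← sq_abs]
      exact pow_le_pow_left₀ (abs_nonneg _) (hc t) 2)

theorem setIntegral_sq_le {κ : Measure I} [IsFiniteMeasure κ] {f : I → ℝ}
    (hf : Measurable f) {c : ℝ} (hc : ∀ t, |f t| ≤ c) (B : Set I) :
    ∫ t in B, f t ^ 2 ∂κ ≤ c ^ 2 * κ.real B := by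
  calc ∫ t in B, f t ^ 2 ∂κ ≤ ∫ _ in B, c ^ 2 ∂κ := by
        refine integral_mono (integrable_sq_of_abs_le hf hc) (integrable_const _) fun t => ?_
        change f t ^ 2 ≤ c ^ 2
        rw [← sq_abs]
        exact pow_le_pow_left₀ (abs_nonneg _) (hc t) 2
    _ = c ^ 2 * κ.real B := by simp [mul_comm]

/-! ### The oracle functional `∫ G² dN` and the variance function. -/

section OneSetup

variable {S : Type*} [mS : MeasurableSpace S] {P : Measure S} (M : Setup P) {C C' : ℝ}

theorem Setup.adapted_N_𝓖 : Adapted M.𝓖 fun t x => M.N x t := fun t =>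
  (M.adapted_N t).mono (((le_sup_left.trans le_sup_left).trans
    (Filtration.le_rightCont _) : M.𝓕 ≤ M.𝓖) t) le_rfl

theorem Setup.measurable_N (t : I) : Measurable fun x => M.N x t :=
  (M.adapted_N t).mono (M.𝓕.le t) le_rfl

theorem Setup.N_zero (x : S) : M.N x 0 = 0 := (M.counting x).zero

theorem Setup.intensity_blam' : IsIntensity P M.𝓖 M.N M.blam := M.intensity_blam

theorem Setup.measurable_predictable_G : Measurable[M.𝓖.predictable] (Function.uncurry M.G) :=
  measurable_predictable_of_leftContinuous M.residual.adapted fun x t => (M.residual.caglad x).1 t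

theorem Setup.measurable_G : Measurable fun z : S × I => M.G z.2 z.1 :=
  (M.measurable_predictable_G.mono (predictable_le_prod _) le_rfl).comp measurable_swap

theorem Setup.measurable_G_path (x : S) : Measurable fun t => M.G t x :=
  M.measurable_G.comp measurable_prodMk_left

/-- The quadratic functional `∫_0^t G_s^2 dN_s`. -/
noncomputable def Setup.quad (t : I) (x : S) : ℝ :=
  ∫ s in Set.Ioc 0 t, M.G s x ^ 2 ∂(M.N x).measure

theorem Setup.quad_nonneg (t : I) (x : S) : 0 ≤ M.quad t x :=
  integral_nonneg fun _ => sq_nonneg _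

theorem Setup.measurable_quad (t : I) : Measurable (M.quad t) := by
  have h1 : StronglyMeasurable fun z : S × I =>
      (Set.Ioc (0 : I) t).indicator (fun s => M.G s z.1 ^ 2) z.2 := by
    have : Measurable ((Prod.snd ⁻¹' Set.Ioc (0 : I) t).indicator
        fun z : S × I => M.G z.2 z.1 ^ 2) :=
      (M.measurable_G.pow_const 2).indicator (measurable_snd measurableSet_Ioc)
    exact this.stronglyMeasurable
  have h2 := h1.integral_kernel_prod_right' (κ := stieltjesKernel M.N M.measurable_N)
  convert h2.measurable using 1
  ext x
  rw [Setup.quad, ← integral_indicator measurableSet_Ioc]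
  rfl

theorem Setup.quad_mono {x : S} (hx : ∀ t, |M.G t x| ≤ C') : Monotone fun t => M.quad t x := by
  intro s t hst
  refine setIntegral_mono_set (integrable_sq_of_abs_le (M.measurable_G_path x) hx).integrableOn
    (Eventually.of_forall fun u => sq_nonneg _) ?_
  exact (Set.Ioc_subset_Ioc_right hst).eventuallyLE

theorem Setup.quad_sub_le {x : S} (hx : ∀ t, |M.G t x| ≤ C') {s t : I} (hst : s ≤ t) :
    M.quad t x - M.quad s x ≤ C' ^ 2 * (M.N x).measure.real (Set.Ioc s t) := by
  have h0 : (0 : I) ≤ s := s.2.1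
  have hi := integrable_sq_of_abs_le (κ := (M.N x).measure) (M.measurable_G_path x) hx
  have : M.quad t x - M.quad s x = ∫ u in Set.Ioc s t, M.G u x ^ 2 ∂(M.N x).measure := by
    rw [Setup.quad, Setup.quad, ← Set.Ioc_union_Ioc_eq_Ioc h0 hst,
      setIntegral_union _ measurableSet_Ioc hi.integrableOn hi.integrableOn]
    · ring
    · exact Set.disjoint_left.2 fun u hu hu' => absurd hu.2 (not_le.2 hu'.1)
  rw [this]
  exact setIntegral_sq_le (M.measurable_G_path x) hx _

theorem Setup.quad_le {x : S} (hx : ∀ t, |M.G t x| ≤ C') (t : I) :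
    M.quad t x ≤ C' ^ 2 * (M.N x).measure.real Set.univ := by
  refine (setIntegral_sq_le (M.measurable_G_path x) hx _).trans ?_
  gcongr
  · exact measure_ne_top _ _
  · exact Set.subset_univ _

variable [IsProbabilityMeasure P]

/-- Pathwise `∫ G² dN ≤ C'² N_1`. The resulting bound depends on `C` and `C'` alone, which makes
Chebyshev's inequality uniform over parameters. -/
theorem Setup.lintegral_quad_sq_le (hC : ∀ᵐ x ∂P, ∀ t, M.blam t x ≤ C)
    (hG : ∀ᵐ x ∂P, ∀ t, |M.G t x| ≤ C') (t : I) :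
    ∫⁻ x, ENNReal.ofReal (M.quad t x ^ 2) ∂P ≤
      ENNReal.ofReal (C' ^ 4) * (2 * (ENNReal.ofReal C * ENNReal.ofReal C) + ENNReal.ofReal C) := by
  refine le_trans ?_ (mul_le_mul_right (M.intensity_blam'.lintegral_sq_measure_univ_le M.counting
    M.adapted_N_𝓖 hC) (ENNReal.ofReal (C' ^ 4)))
  rw [← lintegral_const_mul' _ _ ENNReal.ofReal_ne_top]
  refine lintegral_mono_ae ?_
  filter_upwards [hG] with x hx
  calc ENNReal.ofReal (M.quad t x ^ 2)
      ≤ ENNReal.ofReal ((C' ^ 2 * (M.N x).measure.real Set.univ) ^ 2) :=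
        ENNReal.ofReal_le_ofReal (pow_le_pow_left₀ (M.quad_nonneg t x) (M.quad_le hx t) 2)
    _ = ENNReal.ofReal (C' ^ 4) * (M.N x).measure Set.univ ^ 2 := by
        rw [show (C' ^ 2 * (M.N x).measure.real Set.univ) ^ 2 =
          C' ^ 4 * (M.N x).measure.real Set.univ ^ 2 by ring, ENNReal.ofReal_mul (by positivity),
          ENNReal.ofReal_pow measureReal_nonneg, ofReal_measureReal]

theorem Setup.memLp_quad (hC : ∀ᵐ x ∂P, ∀ t, M.blam t x ≤ C)
    (hG : ∀ᵐ x ∂P, ∀ t, |M.G t x| ≤ C') (t : I) : MemLp (M.quad t) 2 P := by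
  rw [memLp_two_iff_integrable_sq (M.measurable_quad t).aestronglyMeasurable]
  refine ⟨((M.measurable_quad t).pow_const 2).aestronglyMeasurable, ?_⟩
  rw [hasFiniteIntegral_iff_ofReal (Eventually.of_forall fun x => sq_nonneg _)]
  exact (M.lintegral_quad_sq_le hC hG t).trans_lt (by finiteness)

theorem Setup.integral_quad_sq_le (hC : ∀ᵐ x ∂P, ∀ t, M.blam t x ≤ C)
    (hG : ∀ᵐ x ∂P, ∀ t, |M.G t x| ≤ C') (hC0 : 0 ≤ C) (t : I) :
    ∫ x, M.quad t x ^ 2 ∂P ≤ C' ^ 4 * (2 * (C * C) + C) := by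
  rw [← ENNReal.ofReal_le_ofReal_iff (by positivity), ofReal_integral_eq_lintegral_ofReal
    (M.memLp_quad hC hG t).integrable_sq (Eventually.of_forall fun x => sq_nonneg _)]
  refine (M.lintegral_quad_sq_le hC hG t).trans (le_of_eq ?_)
  rw [ENNReal.ofReal_mul (by positivity), ENNReal.ofReal_add (by positivity) hC0,
    ENNReal.ofReal_mul (by positivity), ENNReal.ofReal_mul hC0]
  simp

theorem Setup.integrable_quad (hC : ∀ᵐ x ∂P, ∀ t, M.blam t x ≤ C)
    (hG : ∀ᵐ x ∂P, ∀ t, |M.G t x| ≤ C') (t : I) : Integrable (M.quad t) P :=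
  (M.memLp_quad hC hG t).integrable (by norm_num)

theorem Setup.variance_eq (hC : ∀ᵐ x ∂P, ∀ t, M.blam t x ≤ C)
    (hG : ∀ᵐ x ∂P, ∀ t, |M.G t x| ≤ C') (t : I) :
    M.variance t = ENNReal.ofReal (∫ x, M.quad t x ∂P) := by
  rw [ofReal_integral_eq_lintegral_ofReal (M.integrable_quad hC hG t)
    (Eventually.of_forall fun x => M.quad_nonneg t x), Setup.variance]
  refine lintegral_congr_ae ?_
  filter_upwards [hG] with x hx
  rw [Setup.quad, ofReal_integral_eq_lintegral_ofReal
    (integrable_sq_of_abs_le (M.measurable_G_path x) hx).integrableOn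
    (Eventually.of_forall fun s => sq_nonneg _)]

theorem Setup.variance_toReal (hC : ∀ᵐ x ∂P, ∀ t, M.blam t x ≤ C)
    (hG : ∀ᵐ x ∂P, ∀ t, |M.G t x| ≤ C') (t : I) : (M.variance t).toReal = ∫ x, M.quad t x ∂P := by
  rw [M.variance_eq hC hG, ENNReal.toReal_ofReal (integral_nonneg fun x => M.quad_nonneg t x)]

theorem Setup.variance_mono (hC : ∀ᵐ x ∂P, ∀ t, M.blam t x ≤ C)
    (hG : ∀ᵐ x ∂P, ∀ t, |M.G t x| ≤ C') : Monotone fun t => (M.variance t).toReal := by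
  intro s t hst
  simp only [M.variance_toReal hC hG]
  refine integral_mono_ae (M.integrable_quad hC hG s) (M.integrable_quad hC hG t) ?_
  filter_upwards [hG] with x hx
  exact M.quad_mono hx hst

/-- The increment is `E ∫_{(s,t]} G² dN ≤ C'² E N((s,t])`, and the intensity bound turns the last
factor into `C (t - s)`. This modulus of continuity allows one grid to serve all parameters. -/
theorem Setup.variance_sub_le (hC : ∀ᵐ x ∂P, ∀ t, M.blam t x ≤ C)
    (hG : ∀ᵐ x ∂P, ∀ t, |M.G t x| ≤ C') (hC0 : 0 ≤ C) {s t : I} (hst : s ≤ t) :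
    (M.variance t).toReal - (M.variance s).toReal ≤ C' ^ 2 * C * (t - s) := by
  have hts : (0 : ℝ) ≤ t - s := sub_nonneg.2 (Subtype.coe_le_coe.2 hst)
  have hi : Integrable (fun x => M.quad t x - M.quad s x) P :=
    (M.integrable_quad hC hG t).sub (M.integrable_quad hC hG s)
  rw [M.variance_toReal hC hG, M.variance_toReal hC hG,
    ← integral_sub (M.integrable_quad hC hG t) (M.integrable_quad hC hG s),
    ← ENNReal.ofReal_le_ofReal_iff (by positivity), ofReal_integral_eq_lintegral_ofReal hi
      (by filter_upwards [hG] with x hx; exact sub_nonneg.2 (M.quad_mono hx hst)),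
    mul_assoc, ENNReal.ofReal_mul (by positivity)]
  refine le_trans ?_ (mul_le_mul_right (M.intensity_blam'.lintegral_measure_le M.N_zero
    M.measurable_N hC hst) (ENNReal.ofReal (C' ^ 2)))
  rw [← lintegral_const_mul' _ _ ENNReal.ofReal_ne_top]
  refine lintegral_mono_ae ?_
  filter_upwards [hG] with x hx
  refine (ENNReal.ofReal_le_ofReal (M.quad_sub_le hx hst)).trans (le_of_eq ?_)
  rw [ENNReal.ofReal_mul (by positivity), ofReal_measureReal]

end OneSetup

/-! ### The cost of replacing `G` by its estimate. -/

section Estimate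

variable {S : Type*} [mS : MeasurableSpace S] {D : Type*} [mD : MeasurableSpace D]

theorem IsEstimate.measurable {𝓗 : Filtration I mS} {e : D → I → S → ℝ} (he : IsEstimate 𝓗 e) :
    Measurable fun z : (D × S) × I => e z.1.1 z.2 z.1.2 := by
  have h1 : Measurable fun z : D × (I × S) => e z.1 z.2.1 z.2.2 :=
    Measurable.mono he (sup_le_sup le_rfl (MeasurableSpace.comap_mono (predictable_le_prod 𝓗)))
      le_rfl
  have h2 : Measurable fun z : (D × S) × I => (z.1.1, (z.2, z.1.2)) := by fun_prop
  exact h1.comp h2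

theorem IsEstimate.measurable_predictable {𝓗 : Filtration I mS} {e : D → I → S → ℝ}
    (he : IsEstimate 𝓗 e) (d : D) :
    Measurable[𝓗.predictable] fun z : I × S => e d z.1 z.2 :=
  @Measurable.comp (I × S) (D × (I × S)) ℝ 𝓗.predictable (mD.prod 𝓗.predictable) _ _ _ he
    (@measurable_prodMk_left D (I × S) mD 𝓗.predictable d)

theorem IsEstimate.measurable_path {𝓗 : Filtration I mS} {e : D → I → S → ℝ}
    (he : IsEstimate 𝓗 e) (d : D) (x : S) : Measurable fun t => e d t x :=
  he.measurable.comp (measurable_prodMk_left (x := (d, x)))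

variable {P : Measure S} (M : Setup P)

/-- The integral `∫_0^1 |e_s^2 - G_s^2| dN_s` of an estimate `e` of the residual process. -/
noncomputable def Setup.sqError (e : D → I → S → ℝ) (z : D × S) : ℝ≥0∞ :=
  ∫⁻ s, ENNReal.ofReal |e z.1 s z.2 ^ 2 - M.G s z.2 ^ 2| ∂(M.N z.2).measure

theorem Setup.measurable_sqError {e : D → I → S → ℝ} (he : IsEstimate M.𝓖 e) :
    Measurable (M.sqError e) := by
  have hG : Measurable fun z : (D × S) × I => M.G z.2 z.1.2 :=
    M.measurable_G.comp (f := fun z : (D × S) × I => (z.1.2, z.2)) (by fun_prop)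
  have hf : Measurable fun z : (D × S) × I =>
      ENNReal.ofReal |e z.1.1 z.2 z.1.2 ^ 2 - M.G z.2 z.1.2 ^ 2| :=
    (((he.measurable.pow_const 2).sub (hG.pow_const 2)).abs).ennreal_ofReal
  exact hf.lintegral_kernel_prod_right'
    (κ := (stieltjesKernel M.N M.measurable_N).comap Prod.snd measurable_snd)

variable [IsProbabilityMeasure P]

/-- Factor `e² - G² = (e + G)(e - G)` with first factor at most `2C'`, exchange `dN` for at most `C
ds`, and pass from the `L¹` to the `L²` norm on a probability space. -/
theorem Setup.lintegral_sqError_le {C C' : ℝ} (hC : ∀ᵐ x ∂P, ∀ t, M.blam t x ≤ C)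
    (hG : ∀ᵐ x ∂P, ∀ t, |M.G t x| ≤ C') (hC' : 0 ≤ C') {ν : Measure D} [IsProbabilityMeasure ν]
    {e : D → I → S → ℝ} (he : IsEstimate M.𝓖 e)
    (hbd : ∀ᵐ z ∂ν.prod P, ∀ t, |e z.1 t z.2| ≤ C') :
    ∫⁻ z, M.sqError e z ∂ν.prod P ≤
      ENNReal.ofReal (2 * C') * ENNReal.ofReal C * estimationError ν P M.G e := by
  have hGm : Measurable fun z : D × (S × I) => M.G z.2.2 z.2.1 :=
    M.measurable_G.comp measurable_snd
  have hem : Measurable fun z : D × (S × I) => e z.1 z.2.2 z.2.1 :=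
    he.measurable.comp (f := fun z : D × (S × I) => ((z.1, z.2.1), z.2.2)) (by fun_prop)
  have hdm : Measurable fun z : D × (S × I) =>
      ENNReal.ofReal |M.G z.2.2 z.2.1 - e z.1 z.2.2 z.2.1| :=
    ((hGm.sub hem).abs).ennreal_ofReal
  -- Only for frozen training data is `|G - e|` a `𝓖`-predictable process of the new observation, so
  -- the exchange is made for each `d` and then integrated over `ν`.
  have hfix : ∀ᵐ d ∂ν, ∫⁻ x, M.sqError e (d, x) ∂P ≤ ENNReal.ofReal (2 * C') * ENNReal.ofReal C *
      ∫⁻ x, ∫⁻ s, ENNReal.ofReal |M.G s x - e d s x| ∂volume ∂P := by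
    filter_upwards [Measure.ae_ae_of_ae_prod hbd] with d hd
    have hH : Measurable[M.𝓖.predictable] fun z : I × S =>
        ENNReal.ofReal |M.G z.1 z.2 - e d z.1 z.2| := by
      have h1 := M.measurable_predictable_G
      have h2 := he.measurable_predictable d
      let := M.𝓖.predictable
      exact ((h1.sub h2).abs).ennreal_ofReal
    have hle := M.intensity_blam'.lintegral_le M.N_zero M.measurable_N hC hH
    rw [mul_assoc]
    refine le_trans ?_ (mul_le_mul_right hle _)
    rw [← lintegral_const_mul' _ _ ENNReal.ofReal_ne_top]
    refine lintegral_mono_ae ?_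
    filter_upwards [hd, hG] with x hx1 hx2
    rw [← lintegral_const_mul' _ _ ENNReal.ofReal_ne_top]
    refine lintegral_mono fun s => ?_
    rw [← ENNReal.ofReal_mul (by positivity)]
    refine ENNReal.ofReal_le_ofReal ?_
    rw [show e d s x ^ 2 - M.G s x ^ 2 = -((M.G s x + e d s x) * (M.G s x - e d s x)) by ring,
      abs_neg, abs_mul]
    gcongr
    refine (abs_add_le _ _).trans ?_
    have := hx1 s
    have := hx2 s
    linarith
  calc ∫⁻ z, M.sqError e z ∂ν.prod P
      = ∫⁻ d, ∫⁻ x, M.sqError e (d, x) ∂P ∂ν :=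
        lintegral_prod _ (M.measurable_sqError he).aemeasurable
    _ ≤ ∫⁻ d, ENNReal.ofReal (2 * C') * ENNReal.ofReal C *
          ∫⁻ x, ∫⁻ s, ENNReal.ofReal |M.G s x - e d s x| ∂volume ∂P ∂ν := lintegral_mono_ae hfix
    _ = ENNReal.ofReal (2 * C') * ENNReal.ofReal C *
          ∫⁻ d, ∫⁻ x, ∫⁻ s, ENNReal.ofReal |M.G s x - e d s x| ∂volume ∂P ∂ν :=
        lintegral_const_mul' _ _ (by finiteness)
    _ = ENNReal.ofReal (2 * C') * ENNReal.ofReal C *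
          eLpNorm (fun z : D × (S × I) => M.G z.2.2 z.2.1 - e z.1 z.2.2 z.2.1) 1
            (ν.prod (P.prod volume)) := by
        rw [eLpNorm_one_eq_lintegral_enorm]
        simp only [Real.enorm_eq_ofReal_abs]
        rw [lintegral_prod _ hdm.aemeasurable]
        congr 1
        refine lintegral_congr fun d => ?_
        have hdx : Measurable fun y : S × I => ENNReal.ofReal |M.G y.2 y.1 - e d y.2 y.1| :=
          hdm.comp (measurable_prodMk_left (x := d))
        exact (lintegral_prod _ hdx.aemeasurable).symm
    _ ≤ _ := by
        gcongr
        exact eLpNorm_le_eLpNorm_of_exponent_le one_le_two (hGm.sub hem).aestronglyMeasurable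

end Estimate

/-- The error of the estimates controls the empirical variance function uniformly in time. -/
theorem Setup.abs_empiricalVariance_sub_le {Ω S : Type*} [MeasurableSpace S]
    {P : Measure S} (M : Setup P) {ξ : ℕ → Ω → S} {J : ℕ → Finset ℕ} {n : ℕ}
    {Gh : Training J n S → I → S → ℝ} (hGh : IsEstimate M.𝓖 Gh) {C' δ : ℝ} {ω : Ω}
    (hGω : ∀ j ∈ J n, ∀ t, |M.G t (ξ j ω)| ≤ C')
    (hGhω : ∀ j ∈ J n, ∀ t, |Gh (fun i => ξ i ω) t (ξ j ω)| ≤ C') (hδ : 0 ≤ δ)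
    (herr : ENNReal.ofReal ((J n).card : ℝ)⁻¹ *
      ∑ j ∈ J n, M.sqError Gh ((fun i => ξ i ω), ξ j ω) ≤ ENNReal.ofReal δ) (t : I) :
    |empiricalVariance M J n Gh ξ t ω -
      ((J n).card : ℝ)⁻¹ * ∑ j ∈ J n, M.quad t (ξ j ω)| ≤ δ := by
  rw [← ENNReal.ofReal_le_ofReal_iff hδ]
  refine le_trans ?_ herr
  rw [empiricalVariance, ← mul_sub, ← Finset.sum_sub_distrib, abs_mul,
    abs_of_nonneg (by positivity), ENNReal.ofReal_mul (by positivity)]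
  gcongr
  refine (ENNReal.ofReal_le_ofReal (Finset.abs_sum_le_sum_abs _ _)).trans ?_
  rw [ENNReal.ofReal_sum_of_nonneg fun _ _ => abs_nonneg _]
  refine Finset.sum_le_sum fun j hj => ?_
  have i1 := integrable_sq_of_abs_le (κ := (M.N (ξ j ω)).measure)
    (hGh.measurable_path (fun i => ξ i ω) (ξ j ω)) (hGhω j hj)
  have i2 := integrable_sq_of_abs_le (κ := (M.N (ξ j ω)).measure)
    (M.measurable_G_path (ξ j ω)) (hGω j hj)
  rw [Setup.quad, ← integral_sub i1.integrableOn i2.integrableOn, ← Real.enorm_eq_ofReal_abs]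
  refine (enorm_integral_le_lintegral_enorm _).trans ?_
  simp only [Real.enorm_eq_ofReal_abs]
  -- Enlarging `(0,t]` to all of `[0,1]` removes the dependence on `t`.
  exact setLIntegral_le_lintegral _ _

/-! ### Sample splitting and the non-asymptotic deviation bound. -/

section Sample

theorem map_pi_of_injective {Ω S : Type*} [MeasurableSpace Ω] [MeasurableSpace S]
    {P : Measure S} {μ : Measure Ω} [IsProbabilityMeasure μ] {ξ : ℕ → Ω → S}
    (hξ : ∀ j, Measurable (ξ j)) (hlaw : ∀ j, μ.map (ξ j) = P)
    (hindep : iIndepFun ξ μ) {κ : Type*} [Fintype κ] {g : κ → ℕ} (hg : Function.Injective g) :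
    μ.map (fun ω i => ξ (g i) ω) = Measure.pi fun _ => P := by
  rw [(iIndepFun_iff_map_fun_eq_pi_map fun i => (hξ (g i)).aemeasurable).1 (hindep.precomp hg)]
  simp only [hlaw]

variable {Ω S : Type*} [MeasurableSpace Ω] [mS : MeasurableSpace S] {P : Measure S}
  {μ : Measure Ω} [IsProbabilityMeasure μ] {ξ : ℕ → Ω → S}

instance [IsProbabilityMeasure P] (J : ℕ → Finset ℕ) (n : ℕ) : IsProbabilityMeasure (trainingLaw J n P) := by
  unfold trainingLaw; infer_instance

/-- The training data and an observation outside the training sample are independent. -/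
theorem measurePreserving_training (hξ : ∀ j, Measurable (ξ j)) (hlaw : ∀ j, μ.map (ξ j) = P)
    (hindep : iIndepFun ξ μ) (J : ℕ → Finset ℕ) (n : ℕ) {j : ℕ} (hj : j ∈ J n) :
    MeasurePreserving (fun ω => ((fun i => ξ i ω : Training J n S), ξ j ω)) μ
      ((trainingLaw J n P).prod P) := by
  have htr : Measurable fun ω => (fun i => ξ i ω : Training J n S) :=
    measurable_pi_lambda _ fun i => hξ i
  refine ⟨htr.prodMk (hξ j), ?_⟩
  have hd : Disjoint (Finset.Icc 1 n \ J n) {j} := by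
    rw [Finset.disjoint_singleton_right]; simp [hj]
  have h1 := hindep.indepFun_finset (Finset.Icc 1 n \ J n) {j} hd hξ
  have h2 : IndepFun (fun ω => (fun i => ξ i ω : Training J n S)) (ξ j) μ :=
    h1.comp measurable_id (measurable_pi_apply (⟨j, Finset.mem_singleton_self j⟩ : ({j} : Finset ℕ)))
  rw [(indepFun_iff_map_prod_eq_prod_map_map htr.aemeasurable (hξ j).aemeasurable).1 h2, hlaw]
  congr 1
  exact map_pi_of_injective hξ hlaw hindep Subtype.val_injective

/-- Non-asymptotic bound for the uniform deviation of the empirical variance function. -/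
theorem Setup.measure_iSup_deviation_le [IsProbabilityMeasure P] (M : Setup P) {C C' : ℝ}
    (hC0 : 0 ≤ C) (hC'0 : 0 ≤ C')
    (hC : ∀ᵐ x ∂P, ∀ t, M.blam t x ≤ C) (hG : ∀ᵐ x ∂P, ∀ t, |M.G t x| ≤ C')
    (hξ : ∀ j, Measurable (ξ j)) (hlaw : ∀ j, μ.map (ξ j) = P) (hindep : iIndepFun ξ μ)
    {J : ℕ → Finset ℕ} {n : ℕ} (hJ : 0 < (J n).card) {Gh : Training J n S → I → S → ℝ}
    (hGh : IsEstimate M.𝓖 Gh)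
    (hbd : ∀ᵐ z ∂(trainingLaw J n P).prod P, ∀ t, |Gh z.1 t z.2| ≤ C') {δ : ℝ} (hδ : 0 < δ)
    {m : ℕ} (hm : C' ^ 2 * C ≤ δ * (m + 1)) :
    μ {ω | ENNReal.ofReal (4 * δ) < ⨆ t : I, ENNReal.ofReal
        |empiricalVariance M J n Gh ξ t ω - (M.variance t).toReal|} ≤
      ENNReal.ofReal (2 * C') * ENNReal.ofReal C * estimationError (trainingLaw J n P) P M.G Gh /
        ENNReal.ofReal δ +
      (m + 2 : ℕ) * ENNReal.ofReal (C' ^ 4 * (2 * (C * C) + C) / ((J n).card * δ ^ 2)) := by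
  have hc : (0 : ℝ) < (J n).card := by exact_mod_cast hJ
  have hmp := fun j (hj : j ∈ J n) => measurePreserving_training hξ hlaw hindep J n hj
  set B : ℝ≥0∞ :=
    ENNReal.ofReal (2 * C') * ENNReal.ofReal C * estimationError (trainingLaw J n P) P M.G Gh
  set err : Ω → ℝ≥0∞ := fun ω => ENNReal.ofReal ((J n).card : ℝ)⁻¹ *
    ∑ j ∈ J n, M.sqError Gh ((fun i => ξ i ω), ξ j ω) with herr
  have hsqm : ∀ j ∈ J n, Measurable fun ω => M.sqError Gh ((fun i => ξ i ω), ξ j ω) := fun j hj =>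
    (M.measurable_sqError hGh).comp (hmp j hj).measurable
  have herrm : Measurable err := (Finset.measurable_sum _ hsqm).const_mul _
  have herrE : ∫⁻ ω, err ω ∂μ ≤ B := by
    rw [herr, lintegral_const_mul' _ _ ENNReal.ofReal_ne_top, lintegral_finsetSum' _ fun j hj =>
      (hsqm j hj).aemeasurable]
    -- The summands share the training data and are dependent, but only their means matter: each
    -- pair (training data, `ξ j`) has the product law.
    calc _ ≤ ENNReal.ofReal ((J n).card : ℝ)⁻¹ * ∑ _j ∈ J n, B := by
          gcongr with j hj
          rw [(hmp j hj).lintegral_comp (M.measurable_sqError hGh)]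
          exact M.lintegral_sqError_le hC hG hC'0 hGh hbd
      _ = B := by
          rw [Finset.sum_const, nsmul_eq_mul, ← mul_assoc, ENNReal.ofReal_inv_of_pos hc,
            ENNReal.ofReal_natCast, ENNReal.inv_mul_cancel (by simpa using hJ.ne') (by simp),
            one_mul]
  have hmarkov : μ {ω | ENNReal.ofReal δ ≤ err ω} ≤ B / ENNReal.ofReal δ := by
    refine (meas_ge_le_lintegral_div herrm.aemeasurable (by simpa using hδ)
      ENNReal.ofReal_ne_top).trans ?_
    gcongr
  have hgood : ∀ᵐ ω ∂μ, (∀ j ∈ J n, ∀ t, |M.G t (ξ j ω)| ≤ C') ∧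
      ∀ j ∈ J n, ∀ t, |Gh (fun i => ξ i ω) t (ξ j ω)| ≤ C' := by
    refine Filter.Eventually.and ?_ ?_
    · refine (Finset.eventually_all (J n)).2 fun j _ => ?_
      exact (⟨hξ j, hlaw j⟩ : MeasurePreserving (ξ j) μ P).quasiMeasurePreserving.ae hG
    · refine (Finset.eventually_all (J n)).2 fun j hj => ?_
      exact (hmp j hj).quasiMeasurePreserving.ae hbd
  have hgrid : ∀ k, μ {ω | δ ≤ |((J n).card : ℝ)⁻¹ * ∑ j ∈ J n, M.quad (cellLeft m k) (ξ j ω) -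
      (M.variance (cellLeft m k)).toReal|} ≤
      ENNReal.ofReal (C' ^ 4 * (2 * (C * C) + C) / ((J n).card * δ ^ 2)) := by
    intro k
    rw [M.variance_toReal hC hG]
    exact measure_average_deviation_le hξ hlaw hindep (M.measurable_quad _) (M.memLp_quad hC hG _)
      (M.integral_quad_sq_le hC hG hC0 _) (J n) hJ hδ
  set Bad : ℕ → Set Ω := fun k => {ω | δ ≤ |((J n).card : ℝ)⁻¹ *
    ∑ j ∈ J n, M.quad (cellLeft m k) (ξ j ω) - (M.variance (cellLeft m k)).toReal|}
  -- Off the bad events the deviation is at most `δ` from estimating `G` plus `2δ` from the grid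
  -- comparison, below the allowed `4δ`. An almost sure inclusion suffices, so measurability of the
  -- uncountable supremum is never needed.
  have hsub : {ω | ENNReal.ofReal (4 * δ) < ⨆ t : I, ENNReal.ofReal
      |empiricalVariance M J n Gh ξ t ω - (M.variance t).toReal|} ≤ᵐ[μ]
      ({ω | ENNReal.ofReal δ ≤ err ω} ∪ ⋃ k ∈ Finset.range (m + 2), Bad k : Set Ω) := by
    filter_upwards [hgood] with ω hω hlt
    by_contra hcon
    have hn1 : err ω < ENNReal.ofReal δ := not_le.1 fun h => hcon (Or.inl h)
    have hn2 : ∀ k ≤ m + 1, |((J n).card : ℝ)⁻¹ * ∑ j ∈ J n, M.quad (cellLeft m k) (ξ j ω) -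
        (M.variance (cellLeft m k)).toReal| ≤ δ := fun k hk =>
      (not_le.1 fun h => hcon (Or.inr (Set.mem_biUnion
        (Finset.mem_coe.2 (Finset.mem_range.2 (by omega : k < m + 2))) h))).le
    have hmono : Monotone fun t => ((J n).card : ℝ)⁻¹ * ∑ j ∈ J n, M.quad t (ξ j ω) := by
      intro s t hst
      simp only
      gcongr with j hj
      exact M.quad_mono (hω.1 j hj) hst
    refine absurd hlt (not_lt.2 (iSup_le fun t => ENNReal.ofReal_le_ofReal ?_))
    have d1 := M.abs_empiricalVariance_sub_le hGh hω.1 hω.2 hδ.le hn1.le t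
    have d2 := abs_sub_le_of_grid hmono (M.variance_mono hC hG) hδ.le
      (fun s t hst => M.variance_sub_le hC hG hC0 hst) hm hn2 t
    have d3 := abs_sub_le (empiricalVariance M J n Gh ξ t ω)
      (((J n).card : ℝ)⁻¹ * ∑ j ∈ J n, M.quad t (ξ j ω)) (M.variance t).toReal
    linarith
  calc _ ≤ μ ({ω | ENNReal.ofReal δ ≤ err ω} ∪ ⋃ k ∈ Finset.range (m + 2), Bad k) :=
        measure_mono_ae hsub
    _ ≤ μ {ω | ENNReal.ofReal δ ≤ err ω} + ∑ k ∈ Finset.range (m + 2), μ (Bad k) :=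
        (measure_union_le _ _).trans (by gcongr; exact measure_biUnion_finset_le _ _)
    _ ≤ _ := by
        refine add_le_add hmarkov ((Finset.sum_le_sum fun k _ => hgrid k).trans (le_of_eq ?_))
        rw [Finset.sum_const, Finset.card_range, nsmul_eq_mul]

end Sample

end LCM

/-! ### The uniform limit. -/

theorem mainTheorem10 {Θ : Type*} {S : Θ → Type*} [∀ θ, MeasurableSpace (S θ)]
    {P : ∀ θ, Measure (S θ)} [∀ θ, IsProbabilityMeasure (P θ)]
    (M : ∀ θ, LCM.Setup (P θ))
    (J : ℕ → Finset ℕ) (hJ : ∀ n, J n ⊆ Finset.Icc 1 n)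
    (Lh Gh : ∀ θ n, LCM.Training J n (S θ) → unitInterval → S θ → ℝ)
    (hLh : ∀ θ n, LCM.IsEstimate (M θ).𝓕 (Lh θ n))
    (hGh : ∀ θ n, LCM.IsEstimate (M θ).𝓖 (Gh θ n))
    {Ω : Type*} [MeasurableSpace Ω] (μ : Θ → Measure Ω) [∀ θ, IsProbabilityMeasure (μ θ)]
    (ξ : ∀ θ, ℕ → Ω → S θ) (hξ : ∀ θ j, Measurable (ξ θ j))
    (hlaw : ∀ θ j, (μ θ).map (ξ θ j) = P θ)
    (hindep : ∀ θ, iIndepFun (ξ θ) (μ θ))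
    (hbounds : LCM.UniformBounds M J Lh Gh)
    (hrates : LCM.UniformRates M J Lh Gh) :
    (∀ θ t, (M θ).variance t < ∞) ∧
    ∀ ε : ℝ, 0 < ε →
      Tendsto (fun n => ⨆ θ, μ θ {ω | ENNReal.ofReal ε <
          ⨆ t : unitInterval, ENNReal.ofReal
            |LCM.empiricalVariance (M θ) J n (Gh θ n) (ξ θ) t ω - ((M θ).variance t).toReal|})
        atTop (𝓝 0) := by
  obtain ⟨C, hC0, C', hC'0, hb⟩ := hbounds
  obtain ⟨hcard, hrate⟩ := hrates
  have hC : ∀ θ, ∀ᵐ x ∂P θ, ∀ t, (M θ).blam t x ≤ C := fun θ => (hb θ).1.mono fun _ h => h.2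
  have hG : ∀ θ, ∀ᵐ x ∂P θ, ∀ t, |(M θ).G t x| ≤ C' := fun θ => (hb θ).2.1.mono fun _ h => h.2
  refine ⟨fun θ t => ?_, fun ε hε => ?_⟩
  · rw [(M θ).variance_eq (hC θ) (hG θ)]
    exact ENNReal.ofReal_lt_top
  set δ := ε / 4 with hδdef
  have hδ : 0 < δ := by positivity
  -- The grid size depends only on `C`, `C'` and `ε`, so it stays fixed as `n` grows and as `θ`
  -- varies.
  obtain ⟨m, hm⟩ := exists_nat_ge (C' ^ 2 * C / δ)
  have hm' : C' ^ 2 * C ≤ δ * (m + 1) := by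
    rw [div_le_iff₀ hδ] at hm
    nlinarith
  set K := C' ^ 4 * (2 * (C * C) + C)
  have hlim2 : Tendsto (fun n => ENNReal.ofReal (K / ((J n).card * δ ^ 2))) atTop (𝓝 0) := by
    rw [← ENNReal.ofReal_zero]
    refine ENNReal.tendsto_ofReal (Tendsto.div_atTop tendsto_const_nhds ?_)
    exact (tendsto_natCast_atTop_atTop.comp hcard).atTop_mul_const (by positivity)
  have hlim1 := ENNReal.Tendsto.const_mul (a := ENNReal.ofReal (2 * C') * ENNReal.ofReal C) hrate
    (Or.inr (by finiteness))
  have hlim3 := ENNReal.Tendsto.div_const hlim1 (b := ENNReal.ofReal δ) (Or.inr (by simpa using hδ))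
  have hlim4 := ENNReal.Tendsto.const_mul (a := ((m + 2 : ℕ) : ℝ≥0∞)) hlim2 (Or.inr (by finiteness))
  have hlim := hlim3.add hlim4
  simp only [mul_zero, ENNReal.zero_div, add_zero] at hlim
  refine tendsto_of_tendsto_of_tendsto_of_le_of_le' tendsto_const_nhds hlim
    (Eventually.of_forall fun _ => bot_le) ?_
  -- The deviation bound divides by `|J n|`, so it is available only once `J n` is nonempty.
  filter_upwards [hcard.eventually_gt_atTop 0] with n hn
  refine iSup_le fun θ => ?_
  have h := (M θ).measure_iSup_deviation_le hC0.le hC'0.le (hC θ) (hG θ) (hξ θ) (hlaw θ) (hindep θ)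
    hn (hGh θ n) (((hb θ).2.2 n).mono fun z hz t => (hz t).2) hδ hm'
  rw [show 4 * δ = ε by rw [hδdef]; ring] at h
  refine h.trans ?_
  gcongr
  exact le_iSup_of_le θ (le_max_left _ _)
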